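/- Let $N\ge 1$ and $n=2N$. For $\omega\in\mathbb{R}$ and $f:[-1,1]^{n}\to\mathbb{C}$ put $$I_{n}[f](\omega)=\frac1{n!}\int_{[-1,1]^n} f(x_0,\dots,x_{n-1})\prod_{0\le k<\ell\le n-1}(x_\ell-x_k)^2\,e^{i\omega(x_0+\cdots+x_{n-1})}\,dx_0\cdots dx_{n-1},$$ and let $\mathrm{SF}(m)=\prod_{i=1}^m i!$ be the superfactorial. The weight of a vertex of the cube $[-1,1]^n$ is the absolute difference between the number of its coordinates equal to $+1$ and the number of its coordinates equal to $-1$. Let $\mu_j(\omega)=\int_{-1}^1x^je^{i\omega x}\,dx$ and $h_m(\omega)=\det\big(\mu_{i+j}(\omega)\big)_{i,j=0}^{m}$. (a) Let $f$ be infinitely differentiable on $[-1,1]^{2N}$ and symmetric in its $2N$ arguments, and let $v$ be a vertex of weight $0$ with $f(v)\ne0$. Then, as $\omega\to+\infty$, $$I_{2N}[f](\omega)=\frac{4^{N^2}}{\omega^{2N^2}}\,f(v)\,\mathrm{SF}(N-1)^4+O\big(\omega^{-2N^2-1}\big).$$ (b) For $f\equiv1$ one has $I_{2N}[1](\omega)=h_{2N-1}(\omega)$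 for all real $\omega$, and $h_{2N-1}(\omega)$ is real and strictly positive for all sufficiently large $\omega$ (depending on $N$). (c) Consequently, for all sufficiently large $\omega$ (depending on $N$) there is exactly one monic polynomial $p_{2N}$ of degree $2N$ with complex coefficients such that $\int_{-1}^1p_{2N}(x)\,x^k e^{i\omega x}\,dx=0$ for $k=0,\dots,2N-1$. -/

import Mathlib

namespace Kissing

/-- The cube `[-1,1]^n`. -/
def cube (n : ℕ) : Set (Fin n → ℝ) := Set.Icc (fun _ => -1) (fun _ => 1)

/-- `v` is one of the `2^n` vertices of the cube `[-1,1]^n`. -/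
def IsVertex {n : ℕ} (v : Fin n → ℝ) : Prop := ∀ i, v i = -1 ∨ v i = 1

/-- The weight of a vertex: the absolute difference between the number of its coordinates
`+1` and the number of its coordinates `-1`. -/
noncomputable def weight {n : ℕ} (v : Fin n → ℝ) : ℤ :=
  |((Finset.univ.filter fun i => v i = 1).card : ℤ)
    - ((Finset.univ.filter fun i => v i = -1).card : ℤ)|

/-- `f` is a symmetric function of its `n` arguments on the cube `[-1,1]^n`. -/
def IsSymmetricOnCube {n : ℕ} (f : (Fin n → ℝ) → ℂ) : Prop :=
  ∀ x ∈ cube n, ∀ σ : Equiv.Perm (Fin n), f (x ∘ σ) = f x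

/-- The product of `(x_l - x_k)^2` over all pairs `k < l`. -/
noncomputable def vandermondeSq {n : ℕ} (x : Fin n → ℝ) : ℝ :=
  ∏ k : Fin n, ∏ l ∈ Finset.Ioi k, (x l - x k) ^ 2

/-- The symmetric integral
`I_n[f](ω) = (1/n!) ∫_{[-1,1]^n} f(x) ∏_{k<l} (x_l - x_k)^2 e^{iω(x_0 + ⋯ + x_{n-1})} dx`. -/
noncomputable def symmetricIntegral (n : ℕ) (f : (Fin n → ℝ) → ℂ) (ω : ℝ) : ℂ :=
  (1 / (n.factorial : ℂ)) *
    ∫ x in cube n, f x * (vandermondeSq x : ℂ) *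
      Complex.exp (Complex.I * (ω : ℂ) * ((∑ i, x i : ℝ) : ℂ))

/-- The moments `μ_n(ω) = ∫_{-1}^1 x^n e^{iωx} dx`. -/
noncomputable def moment (n : ℕ) (ω : ℝ) : ℂ :=
  ∫ x in (-1 : ℝ)..1, (x : ℂ) ^ n * Complex.exp (Complex.I * (ω : ℂ) * (x : ℂ))

/-- The Hankel determinant `h_n(ω)`, of the `(n+1) × (n+1)` matrix with entries `μ_{i+j}(ω)`. -/
noncomputable def hankelDet (n : ℕ) (ω : ℝ) : ℂ :=
  Matrix.det (Matrix.of fun i j : Fin (n + 1) => moment (i.val + j.val) ω)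

/-- `p` is a monic orthogonal polynomial of degree `n` for the weight `e^{iωx}` on `[-1,1]`:
`∫_{-1}^1 p(x) x^k e^{iωx} dx = 0` for `k = 0, …, n-1`. -/
def IsMonicOP (n : ℕ) (ω : ℝ) (p : Polynomial ℂ) : Prop :=
  p.Monic ∧ p.natDegree = n ∧ ∀ k < n,
    ∫ x in (-1 : ℝ)..1, p.eval (x : ℂ) * (x : ℂ) ^ k *
      Complex.exp (Complex.I * (ω : ℂ) * (x : ℂ)) = 0

end Kissing

namespace Kissing

open MeasureTheory Filter Asymptotics
open scoped Topology

/-! Each coordinate contributes decay in `ω` according to how strongly the integrand vanishes at the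
endpoints ±1. So the Vandermonde determinant is rewritten in the basis (x-1)^j (x+1)^N, (x-1)^N
(x+1)^j with j < N, which costs a factor 2^(N²) (`det_twoPoint`). The Leibniz expansion of its
square turns the symmetric integral into a finite sum, over pairs of permutations σ, τ, of integrals
of `f` against product kernels (`symmetricIntegral_eq_sum`).

A factor (t-1)^a (t+1)^b e^{iωt} has order ω^-(min(a,b)+1), and the orders add up to at least 2N².
The sum is exactly 2N² only if σ and τ split the coordinates into the same two blocks. Such a term
concentrates at a vertex of weight 0, and a smooth factor vanishing there gains one more order
(`isBigO_integral_endpointKernel_of_vanish`). By symmetry `f` takes the same value at all weight-0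
vertices, so `f - f v` only contributes to the error and the claim reduces to f = 1.

For f = 1, Andréief's identity gives the determinant of the moment matrix in the new basis. After
rescaling rows and columns it tends to a block diagonal matrix with blocks proportional to i^(j+k)
(j+k)!, whose determinants are superfactorials (`isBigO_symmetricIntegral_one_sub`). The same
identity in the monomial basis gives the Hankel determinant. It is real by the reflection x ↦ -x and
positive for large `ω` by its leading term, so the linear system for the orthogonal polynomial is
uniquely solvable. -/

/-! ### Calculus on the cube -/

lemma cube_eq_pi (n : ℕ) : cube n = Set.univ.pi fun _ => Set.Icc (-1 : ℝ) 1 :=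
  (Set.pi_univ_Icc _ _).symm

lemma mem_cube {n : ℕ} {x : Fin n → ℝ} : x ∈ cube n ↔ ∀ i, x i ∈ Set.Icc (-1 : ℝ) 1 := by
  rw [cube_eq_pi, Set.mem_univ_pi]

lemma isCompact_cube (n : ℕ) : IsCompact (cube n) := isCompact_Icc

lemma measurableSet_cube (n : ℕ) : MeasurableSet (cube n) := measurableSet_Icc

lemma uniqueDiffOn_cube (n : ℕ) : UniqueDiffOn ℝ (cube n) := by
  rw [cube_eq_pi]
  exact UniqueDiffOn.pi (fun i _ => uniqueDiffOn_Icc (by norm_num))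

lemma cube_mem_nhds {n : ℕ} {x : Fin n → ℝ} (hx : ∀ i, x i ∈ Set.Ioo (-1 : ℝ) 1) :
    cube n ∈ 𝓝 x := by
  rw [cube_eq_pi]
  exact set_pi_mem_nhds Set.finite_univ fun i _ => Icc_mem_nhds (hx i).1 (hx i).2

/-- The partial derivative of `F` in the direction of the `i`-th coordinate, within the cube. -/
noncomputable def partialDeriv {n : ℕ} (i : Fin n) (F : (Fin n → ℝ) → ℂ) (x : Fin n → ℝ) : ℂ :=
  fderivWithin ℝ F (cube n) x (Pi.single i 1)

lemma contDiffOn_partialDeriv {n : ℕ} (i : Fin n) {F : (Fin n → ℝ) → ℂ}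
    (hF : ContDiffOn ℝ ((⊤ : ℕ∞) : WithTop ℕ∞) F (cube n)) : ContDiffOn ℝ ((⊤ : ℕ∞) : WithTop ℕ∞) (partialDeriv i F) (cube n) :=
  (hF.fderivWithin (uniqueDiffOn_cube n) (m := ((⊤ : ℕ∞) : WithTop ℕ∞)) (by simp)).clm_apply contDiffOn_const

lemma continuousOn_partialDeriv {n : ℕ} (i : Fin n) {F : (Fin n → ℝ) → ℂ}
    (hF : ContDiffOn ℝ 1 F (cube n)) : ContinuousOn (partialDeriv i F) (cube n) :=
  ((hF.fderivWithin (uniqueDiffOn_cube n) (m := 0) (by simp)).clm_apply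
    contDiffOn_const).continuousOn

/-- Divergence theorem for the field whose only nonzero component is `F`, in direction `i`: only the
two faces `x i = ±1` could contribute, and `F` vanishes on them. -/
lemma integral_partialDeriv_eq_zero {n : ℕ} (i : Fin n) {F : (Fin n → ℝ) → ℂ}
    (hF : ContDiffOn ℝ 1 F (cube n))
    (h0 : ∀ x ∈ cube n, x i = 1 ∨ x i = -1 → F x = 0) :
    ∫ x in cube n, partialDeriv i F x = 0 := by
  obtain _ | n := n
  · exact i.elim0
  have key := integral_divergence_of_hasFDerivAt_off_countable' (E := ℂ)
    (fun _ : Fin (n + 1) => (-1 : ℝ)) (fun _ => 1) (fun _ => by norm_num)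
    (fun j x => if j = i then F x else 0)
    (fun j x => if j = i then fderivWithin ℝ F (cube (n + 1)) x else 0) ∅ Set.countable_empty
    (fun j => by
      by_cases hj : j = i
      · simp only [hj, if_true]
        exact hF.continuousOn
      · simpa [hj] using continuousOn_const)
    (fun x hx j => by
      by_cases hj : j = i
      · simp only [hj, if_true]
        have hx' : cube (n + 1) ∈ 𝓝 x := cube_mem_nhds fun i => hx.1 i trivial
        exact ((hF.differentiableOn (by simp)) x (mem_of_mem_nhds hx')).hasFDerivWithinAt.hasFDerivAt
          hx'
      · simpa [hj] using hasFDerivAt_const (0 : ℂ) x)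
    (by
      refine ContinuousOn.integrableOn_compact (isCompact_cube (n + 1)) ?_
      refine continuousOn_finsetSum _ fun j _ => ?_
      by_cases hj : j = i
      · simp only [hj, if_true]
        exact continuousOn_partialDeriv i hF
      · simpa [hj] using continuousOn_const)
  have hL : ∀ x : Fin (n + 1) → ℝ, (∑ j, (if j = i then fderivWithin ℝ F (cube (n + 1)) x else 0)
      (Pi.single j 1)) = partialDeriv i F x := by
    intro x
    rw [Finset.sum_eq_single i]
    · simp [partialDeriv]
    · intro j _ hj; simp [hj]
    · simp
  simp only [hL] at key
  refine key.trans (Finset.sum_eq_zero fun j _ => ?_)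
  by_cases hj : j = i
  · subst hj
    have hface : ∀ c : ℝ, c = 1 ∨ c = -1 →
        ∫ x in Set.Icc ((fun _ : Fin (n + 1) => (-1 : ℝ)) ∘ j.succAbove)
          ((fun _ : Fin (n + 1) => (1 : ℝ)) ∘ j.succAbove), F (j.insertNth c x) = 0 := by
      intro c hc
      refine setIntegral_eq_zero_of_forall_eq_zero fun x hx => h0 _ ?_ (by simpa using hc)
      rw [mem_cube]
      intro k
      rcases Fin.eq_self_or_eq_succAbove j k with rfl | ⟨k, rfl⟩
      · rcases hc with rfl | rfl <;> simp
      · simpa using And.intro (hx.1 k) (hx.2 k)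
    have h1 := hface 1 (by simp)
    have h2 := hface (-1) (by simp)
    simp only [if_true]
    exact (congrArg₂ (· - ·) h1 h2).trans (sub_zero 0)
  · simp [hj]

/-! ### Product kernels and integration by parts in one coordinate -/

/-- A product of functions of one variable. -/
noncomputable def tensor {n : ℕ} (k : Fin n → ℝ → ℂ) (x : Fin n → ℝ) : ℂ := ∏ j, k j (x j)

lemma tensor_update {n : ℕ} (k : Fin n → ℝ → ℂ) (i : Fin n) (u : ℝ → ℂ) (x : Fin n → ℝ) :
    tensor (Function.update k i u) x = u (x i) * ∏ j ∈ Finset.univ.erase i, k j (x j) := by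
  rw [tensor, ← Finset.mul_prod_erase _ _ (Finset.mem_univ i), Function.update_self]
  congr 1
  refine Finset.prod_congr rfl fun j hj => ?_
  rw [Function.update_of_ne (Finset.ne_of_mem_erase hj)]

lemma tensor_eq_mul {n : ℕ} (k : Fin n → ℝ → ℂ) (i : Fin n) (x : Fin n → ℝ) :
    tensor k x = k i (x i) * ∏ j ∈ Finset.univ.erase i, k j (x j) :=
  (Finset.mul_prod_erase _ _ (Finset.mem_univ i)).symm

lemma contDiff_tensor {n : ℕ} {m : WithTop ℕ∞} {k : Fin n → ℝ → ℂ} (hk : ∀ j, ContDiff ℝ m (k j)) :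
    ContDiff ℝ m (tensor k) :=
  contDiff_prod fun j _ => (hk j).comp (contDiff_apply ℝ ℝ j)

lemma continuous_tensor {n : ℕ} {k : Fin n → ℝ → ℂ} (hk : ∀ j, Continuous (k j)) :
    Continuous (tensor k) :=
  continuous_finsetProd _ fun j _ => (hk j).comp (continuous_apply j)

lemma integrableOn_cube_mul {n : ℕ} {H W : (Fin n → ℝ) → ℂ} (hH : ContinuousOn H (cube n))
    (hW : Continuous W) : IntegrableOn (fun x => H x * W x) (cube n) :=
  (hH.mul hW.continuousOn).integrableOn_compact (isCompact_cube n)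

/-- Integration by parts in the `i`-th coordinate, when the boundary terms vanish. -/
lemma integral_mul_tensor_deriv {n : ℕ} (i : Fin n) {H : (Fin n → ℝ) → ℂ}
    (hH : ContDiffOn ℝ 1 H (cube n)) {k : Fin n → ℝ → ℂ} (hk : ∀ j, ContDiff ℝ 1 (k j))
    {w : ℝ → ℂ} (hw : ContDiff ℝ 1 w)
    (h0 : ∀ x ∈ cube n, x i = 1 ∨ x i = -1 → H x * w (x i) = 0) :
    ∫ x in cube n, H x * tensor (Function.update k i (deriv w)) x
      = - ∫ x in cube n, partialDeriv i H x * tensor (Function.update k i w) x := by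
  have hk' : ∀ j, ContDiff ℝ 1 (Function.update k i w j) := by
    intro j
    by_cases hj : j = i
    · subst hj; simpa using hw
    · simpa [hj] using hk j
  have hT : ContDiff ℝ 1 (tensor (Function.update k i w)) := contDiff_tensor hk'
  have hline : ∀ x, fderiv ℝ (tensor (Function.update k i w)) x (Pi.single i 1)
      = tensor (Function.update k i (deriv w)) x := by
    intro x
    have h1 : HasLineDerivAt ℝ (tensor (Function.update k i w))
        (fderiv ℝ (tensor (Function.update k i w)) x (Pi.single i 1)) x (Pi.single i 1) :=
      ((hT.differentiable (by simp)) x).hasFDerivAt.hasLineDerivAt _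
    have h2 : HasLineDerivAt ℝ (tensor (Function.update k i w))
        (tensor (Function.update k i (deriv w)) x) x (Pi.single i 1) := by
      unfold HasLineDerivAt
      have hd : HasDerivAt w (deriv w (x i)) (x i) :=
        ((hw.differentiable (by simp)) (x i)).hasDerivAt
      have hd' : HasDerivAt (fun t : ℝ => w (x i + t)) (deriv w (x i)) 0 := by
        exact HasDerivAt.comp_const_add (x i) 0 (by simpa only [add_zero] using hd)
      have := hd'.mul_const (∏ j ∈ Finset.univ.erase i, k j (x j))
      rw [tensor_update]
      refine this.congr_of_eventuallyEq (Eventually.of_forall fun t => ?_)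
      simp only [tensor_update]
      congr 1
      · simp
      · refine Finset.prod_congr rfl fun j hj => ?_
        simp [Pi.single_eq_of_ne (Finset.ne_of_mem_erase hj)]
    exact HasLineDerivAt.unique h1 h2
  have key := integral_partialDeriv_eq_zero i (F := fun x => H x * tensor (Function.update k i w) x)
    (hH.mul hT.contDiffOn) (fun x hx hxi => by
      rw [tensor_update, ← mul_assoc, h0 x hx hxi, zero_mul])
  have hprod : ∀ x ∈ cube n, partialDeriv i (fun x => H x * tensor (Function.update k i w) x) x
      = H x * tensor (Function.update k i (deriv w)) x
        + partialDeriv i H x * tensor (Function.update k i w) x := by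
    intro x hx
    have hu := uniqueDiffOn_cube n x hx
    have hTd := (hT.differentiable (by simp)) x
    unfold partialDeriv
    rw [fderivWithin_fun_mul hu (hH.differentiableOn (by simp) x hx) hTd.differentiableWithinAt]
    simp only [add_apply, smul_apply, smul_eq_mul]
    rw [hTd.fderivWithin hu, hline, mul_comm (tensor _ _)]
  rw [setIntegral_congr_fun (measurableSet_cube n) hprod, integral_add] at key
  · exact eq_neg_of_add_eq_zero_left key
  · refine integrableOn_cube_mul hH.continuousOn (continuous_tensor fun j => ?_)
    by_cases hj : j = i
    · subst hj; simpa using hw.continuous_deriv (by simp)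
    · simpa [hj] using (hk j).continuous
  · exact integrableOn_cube_mul (continuousOn_partialDeriv i hH) hT.continuous

/-! ### Orders of decay -/

/-- Kernels `k ω t` on `[-1,1]` which, for large `ω`, act as smooth kernels of size `ω ^ (-d)`. -/
def KernelOrder : ℕ → (ℝ → ℝ → ℂ) → Prop
  | 0, k => (∀ ω, ContDiff ℝ 1 (k ω)) ∧ ∃ C, ∀ ω, ∀ t ∈ Set.Icc (-1 : ℝ) 1, ‖k ω t‖ ≤ C
  -- One integration by parts built into the definition: since `w` vanishes at both endpoints, no
  -- boundary term appears whatever the smooth factor is, and each remaining kernel has order `d`.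
  | d + 1, k => (∀ ω, ContDiff ℝ 1 (k ω)) ∧ ∃ w r, KernelOrder d w ∧ KernelOrder d r ∧
      (∀ ω, w ω 1 = 0 ∧ w ω (-1) = 0) ∧ ∀ ω t : ℝ, (ω : ℂ) * k ω t = deriv (w ω) t + r ω t

lemma KernelOrder.contDiff {d : ℕ} {k : ℝ → ℝ → ℂ} (h : KernelOrder d k) (ω : ℝ) :
    ContDiff ℝ 1 (k ω) := by
  cases d with
  | zero => exact h.1 ω
  | succ d => exact h.1 ω

lemma isBigO_inv_pow_succ_of_mul {J : ℝ → ℂ} {D : ℕ}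
    (h : (fun ω : ℝ => (ω : ℂ) * J ω) =O[atTop] fun ω : ℝ => (ω ^ D)⁻¹) :
    J =O[atTop] fun ω : ℝ => (ω ^ (D + 1))⁻¹ := by
  have h1 : (fun ω : ℝ => ((ω : ℂ))⁻¹) =O[atTop] fun ω : ℝ => ω⁻¹ :=
    IsBigO.of_bound 1 (Eventually.of_forall fun ω => by simp)
  refine (h1.mul h).congr' ?_ (Eventually.of_forall fun ω => ?_)
  · filter_upwards [eventually_gt_atTop 0] with ω hω
    have : (ω : ℂ) ≠ 0 := by exact_mod_cast hω.ne'
    field_simp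
  · simp only [pow_succ, mul_inv]; ring

/-- Multiplying by `ω` and integrating by parts in the `i`-th coordinate. -/
lemma mul_integral_mul_tensor {n : ℕ} (i : Fin n) {H : (Fin n → ℝ) → ℂ}
    (hH : ContDiffOn ℝ 1 H (cube n)) {k : Fin n → ℝ → ℂ} (hk : ∀ j, ContDiff ℝ 1 (k j))
    {w r : ℝ → ℂ} (hw : ContDiff ℝ 1 w) (hr : Continuous r)
    (h0 : ∀ x ∈ cube n, x i = 1 ∨ x i = -1 → H x * w (x i) = 0) {c : ℂ}
    (hki : ∀ t, c * k i t = deriv w t + r t) :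
    c * ∫ x in cube n, H x * tensor k x
      = - (∫ x in cube n, partialDeriv i H x * tensor (Function.update k i w) x)
        + ∫ x in cube n, H x * tensor (Function.update k i r) x := by
  rw [← integral_mul_tensor_deriv i hH hk hw h0, ← integral_const_mul, ← integral_add]
  · refine setIntegral_congr_fun (measurableSet_cube n) fun x _ => ?_
    simp only [tensor_update]
    rw [tensor_eq_mul k i]
    linear_combination (H x * ∏ j ∈ Finset.univ.erase i, k j (x j)) * hki (x i)
  all_goals
    refine integrableOn_cube_mul hH.continuousOn (continuous_tensor fun j => ?_)
    by_cases hj : j = i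
    · subst hj
      first
      | simpa using hw.continuous_deriv (by simp)
      | simpa using hr
    · simpa [hj] using (hk j).continuous

lemma sum_update_add_one {n : ℕ} (d : Fin n → ℕ) (i : Fin n) {e : ℕ} (h : d i = e + 1) :
    ∑ j, Function.update d i e j + 1 = ∑ j, d j := by
  rw [Finset.sum_update_of_mem (Finset.mem_univ i), ← Finset.add_sum_erase _ _ (Finset.mem_univ i),
    h, Finset.sdiff_singleton_eq_erase]
  ring

lemma apply_update_apply {n : ℕ} (i : Fin n) (k : Fin n → ℝ → ℝ → ℂ) (w : ℝ → ℝ → ℂ) (ω : ℝ) :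
    (fun j => Function.update k i w j ω) = Function.update (fun j => k j ω) i (w ω) := by
  ext j
  by_cases hj : j = i
  · subst hj; simp
  · simp [hj]

/-- Decay of an oscillatory integral over the cube whose kernel is a product. -/
theorem isBigO_integral_mul_tensor {n : ℕ} (D : ℕ) : ∀ (H : (Fin n → ℝ) → ℂ)
    (k : Fin n → ℝ → ℝ → ℂ) (d : Fin n → ℕ), ContDiffOn ℝ ((⊤ : ℕ∞) : WithTop ℕ∞) H (cube n) →
    (∀ j, KernelOrder (d j) (k j)) → ∑ j, d j = D →
    (fun ω => ∫ x in cube n, H x * tensor (fun j => k j ω) x) =O[atTop]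
      fun ω : ℝ => (ω ^ D)⁻¹ := by
  induction D with
  | zero =>
    intro H k d hH hk hd
    have hd0 : ∀ j, d j = 0 := fun j => by
      simpa using (Finset.sum_eq_zero_iff.1 hd) j (Finset.mem_univ j)
    have hk' : ∀ j, ∃ C, ∀ ω, ∀ t ∈ Set.Icc (-1 : ℝ) 1, ‖k j ω t‖ ≤ C := fun j => by
      have := hk j
      rw [hd0 j] at this
      exact this.2
    choose C hC using hk'
    obtain ⟨M, hM⟩ := (isCompact_cube n).exists_bound_of_continuousOn hH.continuousOn
    refine IsBigO.of_bound (M * (∏ j, C j) * volume.real (cube n)) (Eventually.of_forall fun ω => ?_)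
    simp only [pow_zero, inv_one, norm_one, mul_one]
    refine norm_setIntegral_le_of_norm_le_const (isCompact_cube n).measure_lt_top fun x hx => ?_
    rw [norm_mul, tensor, norm_prod]
    have hM0 : 0 ≤ M := (norm_nonneg _).trans (hM x hx)
    gcongr with j
    · exact hM x hx
    · exact hC j ω _ (mem_cube.1 hx j)
  | succ D ih =>
    intro H k d hH hk hd
    obtain ⟨i, hi⟩ : ∃ i, d i ≠ 0 := by
      by_contra! h
      simp [h] at hd
    obtain ⟨e, he⟩ := Nat.exists_eq_succ_of_ne_zero hi
    have hki := hk i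
    rw [he] at hki
    obtain ⟨-, w, r, hw, hr, hw0, hwr⟩ := hki
    have hsum : ∑ j, Function.update d i e j = D := by
      have := sum_update_add_one d i he
      omega
    have hupd : ∀ u, KernelOrder e u → ∀ j, KernelOrder (Function.update d i e j)
        (Function.update k i u j) := by
      intro u hu j
      by_cases hj : j = i
      · subst hj; simpa using hu
      · simpa [hj] using hk j
    -- Integrating by parts leaves ∂ᵢH against `w` and `H` against `r`, both of total order `D`. The
    -- smooth factor changes, hence the induction over all smooth `H`.
    have h1 := ih (partialDeriv i H) _ _ (contDiffOn_partialDeriv i hH) (hupd w hw) hsum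
    have h2 := ih H _ _ hH (hupd r hr) hsum
    refine isBigO_inv_pow_succ_of_mul ((h1.neg_left.add h2).congr_left fun ω => ?_)
    simp only [apply_update_apply]
    refine (mul_integral_mul_tensor i (hH.of_le (by exact_mod_cast le_top))
      (fun j => (hk j).contDiff ω)
      (hw.contDiff ω) (hr.contDiff ω).continuous ?_ (hwr ω)).symm
    rintro x - (hx | hx) <;> simp [hx, hw0 ω]

/-! ### Oscillating kernels with zeros at both endpoints -/

/-- The oscillating kernel `φ(t) (t² - 1)^m e^{iωt}`. -/
noncomputable def oscKernel (φ : Polynomial ℂ) (m : ℕ) (ω t : ℝ) : ℂ :=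
  φ.eval (t : ℂ) * ((t : ℂ) ^ 2 - 1) ^ m * Complex.exp (Complex.I * (ω : ℂ) * (t : ℂ))

lemma contDiff_polynomial_eval_ofReal (φ : Polynomial ℂ) {m : WithTop ℕ∞} :
    ContDiff ℝ m fun t : ℝ => φ.eval (t : ℂ) := by
  have h1 : ContDiff ℝ m fun z : ℂ => φ.eval z := by
    simpa using φ.contDiff_aeval (𝕜 := ℂ) m |>.restrict_scalars ℝ
  exact h1.comp Complex.ofRealCLM.contDiff

lemma contDiff_oscKernel (φ : Polynomial ℂ) (m : ℕ) (ω : ℝ) {l : WithTop ℕ∞} :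
    ContDiff ℝ l (oscKernel φ m ω) := by
  have h1 := contDiff_polynomial_eval_ofReal φ (m := l)
  have h2 : ContDiff ℝ l fun t : ℝ => (t : ℂ) := Complex.ofRealCLM.contDiff
  unfold oscKernel
  exact (h1.mul ((h2.pow 2).sub contDiff_const |>.pow m)).mul (contDiff_const.mul h2).cexp

lemma norm_exp_I_mul (ω t : ℝ) : ‖Complex.exp (Complex.I * (ω : ℂ) * (t : ℂ))‖ = 1 := by
  rw [mul_assoc, mul_comm, ← Complex.ofReal_mul, Complex.norm_exp_ofReal_mul_I]

lemma hasDerivAt_exp_I_mul (ω t : ℝ) :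
    HasDerivAt (fun t : ℝ => Complex.exp (Complex.I * (ω : ℂ) * (t : ℂ)))
      (Complex.I * ω * Complex.exp (Complex.I * (ω : ℂ) * (t : ℂ))) t := by
  have h := ((hasDerivAt_id t).ofReal_comp.const_mul (Complex.I * (ω : ℂ))).cexp
  simpa [mul_comm] using h

lemma hasDerivAt_polynomial_eval_ofReal (φ : Polynomial ℂ) (t : ℝ) :
    HasDerivAt (fun t : ℝ => φ.eval (t : ℂ)) (φ.derivative.eval (t : ℂ)) t :=
  (φ.hasDerivAt (t : ℂ)).comp_ofReal

/-- Differentiating (t²-1)^(m+1) φ leaves a factor (t²-1)^m, so kernels of this shape are closed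
under integration by parts, with `m` dropping by one. -/
lemma hasDerivAt_oscKernel_succ (φ : Polynomial ℂ) (m : ℕ) (ω t : ℝ) :
    HasDerivAt (oscKernel φ (m + 1) ω)
      (Complex.I * ω * oscKernel φ (m + 1) ω t
        + oscKernel (φ.derivative * (Polynomial.X ^ 2 - 1) + ((2 * (m + 1) : ℕ) : Polynomial ℂ) * Polynomial.X * φ)
            m ω t) t := by
  have h1 := hasDerivAt_polynomial_eval_ofReal φ t
  have h2 : HasDerivAt (fun t : ℝ => ((t : ℂ) ^ 2 - 1) ^ (m + 1))
      ((m + 1 : ℕ) * ((t : ℂ) ^ 2 - 1) ^ m * (2 * t)) t := by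
    have := (((hasDerivAt_id t).ofReal_comp.fun_pow 2).sub_const (1 : ℂ)).fun_pow (m + 1)
    simpa using this
  refine ((h1.mul h2).mul (hasDerivAt_exp_I_mul ω t)).congr_deriv ?_
  simp only [oscKernel, Polynomial.eval_add, Polynomial.eval_mul, Polynomial.eval_sub,
    Polynomial.eval_pow, Polynomial.eval_X, Polynomial.eval_one, Polynomial.eval_natCast, Pi.mul_apply]
  push_cast
  ring

lemma hasDerivAt_oscKernel_zero (φ : Polynomial ℂ) (ω t : ℝ) :
    HasDerivAt (oscKernel φ 0 ω)
      (Complex.I * ω * oscKernel φ 0 ω t + oscKernel φ.derivative 0 ω t) t := by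
  have h := (hasDerivAt_polynomial_eval_ofReal φ t).mul (hasDerivAt_exp_I_mul ω t)
  have he : oscKernel φ 0 ω = (fun t : ℝ => φ.eval (t : ℂ)) *
      fun t : ℝ => Complex.exp (Complex.I * (ω : ℂ) * (t : ℂ)) := by
    ext t
    simp [oscKernel]
  rw [he]
  refine h.congr_deriv ?_
  simp only [oscKernel, Pi.mul_apply]
  ring

lemma exists_bound_oscKernel (φ : Polynomial ℂ) (m : ℕ) :
    ∃ C, ∀ ω, ∀ t ∈ Set.Icc (-1 : ℝ) 1, ‖oscKernel φ m ω t‖ ≤ C := by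
  obtain ⟨C, hC⟩ := (isCompact_Icc (a := (-1 : ℝ)) (b := 1)).exists_bound_of_continuousOn
    (contDiff_oscKernel φ m 0 (l := 0)).continuous.continuousOn
  refine ⟨C, fun ω t ht => le_trans (le_of_eq ?_) (hC t ht)⟩
  simp only [oscKernel, norm_mul, norm_exp_I_mul]

lemma kernelOrder_const_mul {d : ℕ} : ∀ {k : ℝ → ℝ → ℂ} (c : ℂ), KernelOrder d k →
    KernelOrder d fun ω t => c * k ω t := by
  induction d with
  | zero =>
    rintro k c ⟨h1, C, hC⟩
    refine ⟨fun ω => contDiff_const.mul (h1 ω), ‖c‖ * C, fun ω t ht => ?_⟩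
    rw [norm_mul]
    gcongr
    exact hC ω t ht
  | succ d ih =>
    rintro k c ⟨h1, w, r, hw, hr, hw0, h⟩
    refine ⟨fun ω => contDiff_const.mul (h1 ω), _, _, ih c hw, ih c hr, fun ω => by
      simp [hw0 ω], fun ω t => ?_⟩
    rw [deriv_const_mul _ ((hw.contDiff ω).differentiable (by simp) t)]
    linear_combination c * h ω t

/-- Each zero at both endpoints permits one integration by parts without boundary terms. One further
order comes from the base case, where boundary terms exist but are bounded. -/
theorem kernelOrder_oscKernel (m : ℕ) : ∀ φ : Polynomial ℂ,
    KernelOrder (m + 1) (oscKernel φ m) := by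
  induction m with
  | zero =>
    intro φ
    -- From the antiderivative -i·k the linear interpolant of the endpoint values is subtracted, so
    -- that `w` vanishes at ±1. The slope of the interpolant goes into `r`.
    refine ⟨fun ω => contDiff_oscKernel φ 0 ω, fun ω t => -Complex.I * (oscKernel φ 0 ω t
      - (oscKernel φ 0 ω 1 * ((1 + t) / 2) + oscKernel φ 0 ω (-1) * ((1 - t) / 2))),
      fun ω t => Complex.I * (oscKernel φ.derivative 0 ω t
        - (oscKernel φ 0 ω 1 - oscKernel φ 0 ω (-1)) / 2), ?_, ?_, ?_, ?_⟩
    · refine kernelOrder_const_mul (d := 0) _ ?_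
      obtain ⟨C, hC⟩ := exists_bound_oscKernel φ 0
      refine ⟨fun ω => ?_, C + (C * 1 + C * 1), fun ω t ht => ?_⟩
      · have h2 : ContDiff ℝ 1 fun t : ℝ => (t : ℂ) := Complex.ofRealCLM.contDiff
        have := contDiff_oscKernel φ 0 ω (l := 1)
        fun_prop
      · have hC0 : 0 ≤ C := (norm_nonneg _).trans (hC ω t ht)
        refine (norm_sub_le _ _).trans (add_le_add (hC ω t ht) ((norm_add_le _ _).trans ?_))
        rw [norm_mul, norm_mul]
        gcongr
        · exact hC ω 1 (by norm_num)
        · rw [show ((1 : ℂ) + t) / 2 = (((1 + t) / 2 : ℝ) : ℂ) by push_cast; ring,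
            Complex.norm_real, Real.norm_eq_abs, abs_le]
          constructor <;> linarith [ht.1, ht.2]
        · exact hC ω (-1) (by norm_num)
        · rw [show ((1 : ℂ) - t) / 2 = (((1 - t) / 2 : ℝ) : ℂ) by push_cast; ring,
            Complex.norm_real, Real.norm_eq_abs, abs_le]
          constructor <;> linarith [ht.1, ht.2]
    · refine kernelOrder_const_mul (d := 0) _ ?_
      obtain ⟨C, hC⟩ := exists_bound_oscKernel φ 0
      obtain ⟨C', hC'⟩ := exists_bound_oscKernel φ.derivative 0
      refine ⟨fun ω => (contDiff_oscKernel _ 0 ω).sub contDiff_const, C' + (C + C) / 2,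
        fun ω t ht => (norm_sub_le _ _).trans (add_le_add (hC' ω t ht) ?_)⟩
      rw [norm_div, Complex.norm_ofNat]
      gcongr
      exact (norm_sub_le _ _).trans (add_le_add (hC ω 1 (by norm_num)) (hC ω (-1) (by norm_num)))
    · intro ω
      constructor <;> push_cast <;> ring
    · intro ω t
      have h1 := hasDerivAt_oscKernel_zero φ ω t
      have hid : HasDerivAt (fun t : ℝ => (t : ℂ)) 1 t := (hasDerivAt_id t).ofReal_comp
      have h2 := (((hid.const_add 1).div_const 2).const_mul (oscKernel φ 0 ω 1)).add
        (((hid.const_sub 1).div_const 2).const_mul (oscKernel φ 0 ω (-1)))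
      have h3 := ((h1.sub h2).const_mul (-Complex.I)).deriv
      simp only [Pi.sub_apply, Pi.add_apply] at h3
      rw [h3]
      linear_combination ((ω : ℂ) * oscKernel φ 0 ω t) * Complex.I_mul_I
  | succ m ih =>
    intro φ
    -- Here -i·k already vanishes at ±1; absorbing one factor t²-1 into the polynomial lets the
    -- induction hypothesis apply to it.
    refine ⟨fun ω => contDiff_oscKernel φ (m + 1) ω,
      fun ω t => -Complex.I * oscKernel (φ * (Polynomial.X ^ 2 - 1)) m ω t, fun ω t => Complex.I *
      oscKernel (φ.derivative * (Polynomial.X ^ 2 - 1) + ((2 * (m + 1) : ℕ) : Polynomial ℂ) * Polynomial.X * φ) m ω t,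
      kernelOrder_const_mul _ (ih _), kernelOrder_const_mul _ (ih _), ?_, ?_⟩
    · intro ω
      simp [oscKernel]
    · intro ω t
      have h1 : (fun t => -Complex.I * oscKernel (φ * (Polynomial.X ^ 2 - 1)) m ω t)
          = fun t => -Complex.I * oscKernel φ (m + 1) ω t := by
        ext t
        simp only [oscKernel, Polynomial.eval_mul, Polynomial.eval_sub, Polynomial.eval_pow,
          Polynomial.eval_X, Polynomial.eval_one]
        ring
      beta_reduce
      rw [h1, ((hasDerivAt_oscKernel_succ φ m ω t).const_mul (-Complex.I)).deriv]
      linear_combination ((ω : ℂ) * oscKernel φ (m + 1) ω t) * Complex.I_mul_I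

/-- If the smooth factor vanishes on the faces `x i = ±1`, one more order of decay is gained. -/
theorem isBigO_integral_mul_tensor_of_vanish {n : ℕ} (i : Fin n) {H : (Fin n → ℝ) → ℂ}
    (hH : ContDiffOn ℝ ((⊤ : ℕ∞) : WithTop ℕ∞) H (cube n)) (h0 : ∀ x ∈ cube n, x i = 1 ∨ x i = -1 → H x = 0) (m : ℕ) :
    ∀ (φ : Polynomial ℂ) (k : Fin n → ℝ → ℝ → ℂ) (d : Fin n → ℕ),
    (∀ j, KernelOrder (d j) (k j)) → k i = oscKernel φ m → d i = m + 1 →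
    (fun ω => ∫ x in cube n, H x * tensor (fun j => k j ω) x) =O[atTop]
      fun ω : ℝ => (ω ^ (∑ j, d j + 1))⁻¹ := by
  have hH1 : ContDiffOn ℝ 1 H (cube n) := hH.of_le (by exact_mod_cast le_top)
  induction m with
  | zero =>
    intro φ k d hk hki hdi
    have hupd : ∀ u : Polynomial ℂ, ∀ j, KernelOrder (d j)
        (Function.update k i (fun ω t => Complex.I * oscKernel u 0 ω t) j) := by
      intro u j
      by_cases hj : j = i
      · subst hj
        simpa [hdi] using kernelOrder_const_mul Complex.I (kernelOrder_oscKernel 0 u)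
      · simpa [hj] using hk j
    -- Since `H` kills the boundary terms, no interpolant is needed. Both resulting kernels keep
    -- order 1 in coordinate `i`, so dividing by `ω` is a pure gain.
    have h1 := isBigO_integral_mul_tensor _ (partialDeriv i H) _ _ (contDiffOn_partialDeriv i hH)
      (hupd φ) rfl
    have h2 := isBigO_integral_mul_tensor _ H _ _ hH (hupd φ.derivative) rfl
    refine isBigO_inv_pow_succ_of_mul ((h1.add h2).congr_left fun ω => ?_)
    simp only [apply_update_apply]
    have key := mul_integral_mul_tensor i hH1 (fun j => (hk j).contDiff ω)
      (w := fun t => -Complex.I * oscKernel φ 0 ω t)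
      (r := fun t => Complex.I * oscKernel φ.derivative 0 ω t)
      (contDiff_const.mul (contDiff_oscKernel φ 0 ω))
      (contDiff_const.mul (contDiff_oscKernel φ.derivative 0 ω (l := 0))).continuous
      (fun x hx hxi => by rw [h0 x hx hxi, zero_mul]) (c := ω) (fun t => by
        rw [hki, ((hasDerivAt_oscKernel_zero φ ω t).const_mul (-Complex.I)).deriv]
        linear_combination ((ω : ℂ) * oscKernel φ 0 ω t) * Complex.I_mul_I)
    rw [key]
    simp only [tensor_update, ← integral_neg]
    congr 2
    ext x
    ring
  | succ m ih =>
    intro φ k d hk hki hdi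
    set ψ : Polynomial ℂ :=
      φ.derivative * (Polynomial.X ^ 2 - 1) + ((2 * (m + 1) : ℕ) : Polynomial ℂ) * Polynomial.X * φ with hψ
    -- The ∂ᵢH term keeps the full order. The other term loses one order in coordinate `i`, but `H`
    -- still vanishes on the faces, so the induction hypothesis restores it.
    have h1 := isBigO_integral_mul_tensor _ (partialDeriv i H) _ _ (contDiffOn_partialDeriv i hH)
      hk rfl
    have hupd : ∀ j, KernelOrder (Function.update d i (m + 1) j)
        (Function.update k i (oscKernel ψ m) j) := by
      intro j
      by_cases hj : j = i
      · subst hj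
        simpa using kernelOrder_oscKernel m ψ
      · simpa [hj] using hk j
    have h2 := ih ψ _ _ hupd (by simp) (by simp)
    rw [sum_update_add_one d i hdi] at h2
    refine isBigO_inv_pow_succ_of_mul (((h1.const_mul_left Complex.I).add
      (h2.const_mul_left Complex.I)).congr_left fun ω => ?_)
    simp only [apply_update_apply]
    have key := mul_integral_mul_tensor i hH1 (fun j => (hk j).contDiff ω)
      (w := fun t => -Complex.I * oscKernel φ (m + 1) ω t)
      (r := fun t => Complex.I * oscKernel ψ m ω t)
      (contDiff_const.mul (contDiff_oscKernel φ (m + 1) ω))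
      (contDiff_const.mul (contDiff_oscKernel ψ m ω (l := 0))).continuous
      (fun x hx hxi => by rw [h0 x hx hxi, zero_mul]) (c := ω) (fun t => by
        rw [hki, ((hasDerivAt_oscKernel_succ φ m ω t).const_mul (-Complex.I)).deriv]
        linear_combination ((ω : ℂ) * oscKernel φ (m + 1) ω t) * Complex.I_mul_I)
    rw [key]
    simp only [tensor_update, ← integral_neg, ← integral_const_mul]
    congr 2
    · ext x
      rw [tensor_eq_mul _ i, hki]
      ring
    · ext x
      ring

/-! ### Endpoint kernels and smooth factors vanishing at a vertex -/

/-- The oscillating kernel `(t - 1)^a (t + 1)^b e^{iωt}`. -/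
noncomputable def endpointKernel (a b : ℕ) (ω t : ℝ) : ℂ :=
  ((t : ℂ) - 1) ^ a * ((t : ℂ) + 1) ^ b * Complex.exp (Complex.I * (ω : ℂ) * (t : ℂ))

lemma endpointKernel_add (a b c : ℕ) :
    endpointKernel (c + a) (c + b)
      = oscKernel ((Polynomial.X - 1) ^ a * (Polynomial.X + 1) ^ b) c := by
  ext ω t
  simp only [endpointKernel, oscKernel, Polynomial.eval_mul, Polynomial.eval_pow,
    Polynomial.eval_sub, Polynomial.eval_add, Polynomial.eval_X, Polynomial.eval_one]
  rw [show ((t : ℂ) ^ 2 - 1) = (t - 1) * (t + 1) by ring, mul_pow]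
  ring

lemma kernelOrder_endpointKernel (a b : ℕ) :
    KernelOrder (min a b + 1) (endpointKernel a b) := by
  have h := endpointKernel_add (a - min a b) (b - min a b) (min a b)
  rw [Nat.add_sub_cancel' (min_le_left a b), Nat.add_sub_cancel' (min_le_right a b)] at h
  rw [h]
  exact kernelOrder_oscKernel _ _

/-- The surplus zero at the endpoint -v is split off as t + v, to be moved into the smooth factor,
which then vanishes on the face opposite to `v`, at no cost in kernel order. -/
lemma endpointKernel_eq_mul_oscKernel {a b : ℕ} {v : ℝ} (h : v = 1 ∧ a < b ∨ v = -1 ∧ b < a) :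
    ∃ φ, ∀ ω t : ℝ, endpointKernel a b ω t = ((t : ℂ) + v) * oscKernel φ (min a b) ω t := by
  rcases h with ⟨rfl, h⟩ | ⟨rfl, h⟩
  · obtain ⟨c, rfl⟩ := Nat.exists_eq_add_of_lt h
    refine ⟨(Polynomial.X - 1) ^ 0 * (Polynomial.X + 1) ^ c, fun ω t => ?_⟩
    rw [min_eq_left h.le, ← endpointKernel_add]
    simp only [endpointKernel]
    push_cast
    ring
  · obtain ⟨c, rfl⟩ := Nat.exists_eq_add_of_lt h
    refine ⟨(Polynomial.X - 1) ^ c * (Polynomial.X + 1) ^ 0, fun ω t => ?_⟩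
    rw [min_eq_right h.le, ← endpointKernel_add]
    simp only [endpointKernel]
    push_cast
    ring

/-- Replace the coordinates of `x` with index below `m` by those of `v`. -/
def replaceBelow {n : ℕ} (v : Fin n → ℝ) (m : ℕ) (x : Fin n → ℝ) : Fin n → ℝ :=
  fun j => if (j : ℕ) < m then v j else x j

lemma contDiff_replaceBelow {n : ℕ} (v : Fin n → ℝ) (m : ℕ) {l : WithTop ℕ∞} :
    ContDiff ℝ l (replaceBelow v m) := by
  refine contDiff_pi.2 fun j => ?_
  by_cases hj : (j : ℕ) < m
  · simpa [replaceBelow, hj] using contDiff_const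
  · simpa [replaceBelow, hj] using contDiff_apply ℝ ℝ j

lemma replaceBelow_mem_cube {n : ℕ} {v x : Fin n → ℝ} (hv : v ∈ cube n) (hx : x ∈ cube n) (m : ℕ) :
    replaceBelow v m x ∈ cube n := by
  rw [mem_cube] at *
  intro j
  unfold replaceBelow
  split_ifs
  · exact hv j
  · exact hx j

/-- The oscillatory integral of a smooth function vanishing at the vertex that governs its leading
term gains one order of decay. -/
theorem isBigO_integral_endpointKernel_of_vanish {n : ℕ} {g : (Fin n → ℝ) → ℂ}
    (hg : ContDiffOn ℝ ((⊤ : ℕ∞) : WithTop ℕ∞) g (cube n)) {v : Fin n → ℝ} (hgv : g v = 0)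
    {a b : Fin n → ℕ} (hv : ∀ i, v i = 1 ∧ a i < b i ∨ v i = -1 ∧ b i < a i) :
    (fun ω => ∫ x in cube n, g x * tensor (fun j => endpointKernel (a j) (b j) ω) x) =O[atTop]
      fun ω : ℝ => (ω ^ (∑ j, (min (a j) (b j) + 1) + 1))⁻¹ := by
  have hvc : v ∈ cube n := by
    rw [mem_cube]
    intro i
    rcases hv i with h | h <;> rw [h.1] <;> norm_num
  have hsm : ∀ m, ContDiffOn ℝ ((⊤ : ℕ∞) : WithTop ℕ∞) (fun x => g (replaceBelow v m x)) (cube n) :=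
    fun m => hg.comp (contDiff_replaceBelow v m).contDiffOn
      fun x hx => replaceBelow_mem_cube hvc hx m
  have hcont : ∀ ω, Continuous (tensor (fun j => endpointKernel (a j) (b j) ω)) := fun ω =>
    continuous_tensor fun j => ((kernelOrder_endpointKernel _ _).contDiff ω).continuous
  -- Terms of the telescoping sum for g(x) - g(v), with one coordinate replaced at a time. The
  -- `m`-th difference vanishes where `x i = v i`, and the factor `x i + v i` taken from the kernel
  -- vanishes on the opposite face.
  have hterm : ∀ m ∈ Finset.range n, (fun ω => ∫ x in cube n,
      (g (replaceBelow v m x) - g (replaceBelow v (m + 1) x))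
        * tensor (fun j => endpointKernel (a j) (b j) ω) x) =O[atTop]
      fun ω : ℝ => (ω ^ (∑ j, (min (a j) (b j) + 1) + 1))⁻¹ := by
    intro m hm
    set i : Fin n := ⟨m, Finset.mem_range.1 hm⟩
    obtain ⟨φ, hφ⟩ := endpointKernel_eq_mul_oscKernel (hv i)
    have key := isBigO_integral_mul_tensor_of_vanish i
      (H := fun x => (g (replaceBelow v m x) - g (replaceBelow v (m + 1) x)) * ((x i : ℂ) + v i))
      (((hsm m).sub (hsm (m + 1))).mul (((Complex.ofRealCLM.contDiff.comp
        (contDiff_apply ℝ ℝ i)).add contDiff_const).contDiffOn)) (by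
        intro x hx hxi
        have hcase : x i = v i ∨ x i + v i = 0 := by
          rcases hxi with h | h <;> rcases hv i with ⟨h', -⟩ | ⟨h', -⟩ <;> rw [h, h'] <;> norm_num
        rcases hcase with h | h
        · have : replaceBelow v m x = replaceBelow v (m + 1) x := by
            ext j
            unfold replaceBelow
            by_cases hj : (j : ℕ) = m
            · have : j = i := Fin.ext hj
              subst this
              simp [hj, h]
            · have : (j : ℕ) < m ↔ (j : ℕ) < m + 1 := by omega
              simp only [this]
          rw [this, sub_self, zero_mul]
        · rw [← Complex.ofReal_add, h]; simp) (min (a i) (b i)) φ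
      (Function.update (fun j => endpointKernel (a j) (b j)) i (oscKernel φ (min (a i) (b i))))
      (fun j => min (a j) (b j) + 1) (fun j => by
        by_cases hj : j = i
        · subst hj
          simpa using kernelOrder_oscKernel _ φ
        · simpa [hj] using kernelOrder_endpointKernel (a j) (b j)) (by simp) rfl
    refine key.congr_left fun ω => ?_
    refine setIntegral_congr_fun (measurableSet_cube n) fun x _ => ?_
    simp only [apply_update_apply, tensor_update]
    rw [tensor_eq_mul _ i, hφ]
    ring
  refine (IsBigO.sum hterm).congr_left fun ω => ?_
  rw [Finset.sum_apply, ← integral_finsetSum _ fun m _ => integrableOn_cube_mul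
    ((hsm m).sub (hsm (m + 1))).continuousOn (hcont ω)]
  refine setIntegral_congr_fun (measurableSet_cube n) fun x _ => ?_
  rw [← Finset.sum_mul, Finset.sum_range_sub' (fun m => g (replaceBelow v m x))]
  have h0 : replaceBelow v 0 x = x := by ext j; simp [replaceBelow]
  have hn : replaceBelow v n x = v := by ext j; simp [replaceBelow]
  rw [h0, hn, hgv, sub_zero]

/-! ### Squared determinants and Andréief's identity -/

lemma integral_cube_tensor {n : ℕ} (k : Fin n → ℝ → ℂ) :
    ∫ x in cube n, tensor k x = ∏ j, ∫ t in (-1 : ℝ)..1, k j t := by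
  unfold tensor
  rw [cube_eq_pi, volume_pi, Measure.restrict_pi_pi, integral_fintype_prod_eq_prod]
  refine Finset.prod_congr rfl fun j _ => ?_
  rw [intervalIntegral.integral_of_le (by norm_num), integral_Icc_eq_integral_Ioc]

lemma det_sq_mul_tensor {n : ℕ} (p : Fin n → ℝ → ℂ) (w : ℝ → ℂ) (x : Fin n → ℝ) :
    (Matrix.of fun j i => p j (x i)).det ^ 2 * tensor (fun _ => w) x
      = ∑ σ : Equiv.Perm (Fin n), ∑ τ : Equiv.Perm (Fin n),
        ((Equiv.Perm.sign σ : ℤ) : ℂ) * ((Equiv.Perm.sign τ : ℤ) : ℂ) *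
          tensor (fun i t => p (σ i) t * p (τ i) t * w t) x := by
  rw [Matrix.det_apply', sq, Finset.sum_mul_sum]
  simp only [Finset.sum_mul]
  refine Finset.sum_congr rfl fun σ _ => Finset.sum_congr rfl fun τ _ => ?_
  simp only [Matrix.of_apply, tensor, Finset.prod_mul_distrib]
  ring

lemma integral_mul_det_sq_mul_tensor {n : ℕ} {f : (Fin n → ℝ) → ℂ} (hf : ContinuousOn f (cube n))
    {p : Fin n → ℝ → ℂ} (hp : ∀ j, Continuous (p j)) {w : ℝ → ℂ} (hw : Continuous w) :
    ∫ x in cube n, f x * ((Matrix.of fun j i => p j (x i)).det ^ 2 * tensor (fun _ => w) x)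
      = ∑ σ : Equiv.Perm (Fin n), ∑ τ : Equiv.Perm (Fin n),
        ((Equiv.Perm.sign σ : ℤ) : ℂ) * ((Equiv.Perm.sign τ : ℤ) : ℂ) *
          ∫ x in cube n, f x * tensor (fun i t => p (σ i) t * p (τ i) t * w t) x := by
  have hint : ∀ σ τ : Equiv.Perm (Fin n), IntegrableOn (fun x =>
      ((Equiv.Perm.sign σ : ℤ) : ℂ) * ((Equiv.Perm.sign τ : ℤ) : ℂ) *
      (f x * tensor (fun i t => p (σ i) t * p (τ i) t * w t) x)) (cube n) := fun σ τ =>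
    (integrableOn_cube_mul hf (continuous_tensor fun j => ((hp _).mul (hp _)).mul hw)).const_mul _
  simp only [← integral_const_mul]
  simp_rw [← integral_finsetSum _ fun τ _ => hint _ τ]
  rw [← integral_finsetSum _ fun σ _ => integrable_finsetSum _ fun τ _ => hint σ τ]
  refine setIntegral_congr_fun (measurableSet_cube n) fun x _ => ?_
  simp only [det_sq_mul_tensor, Finset.mul_sum]
  refine Finset.sum_congr rfl fun σ _ => Finset.sum_congr rfl fun τ _ => ?_
  ring

/-- Andréief's identity on the cube. -/
theorem integral_det_sq_mul_tensor {n : ℕ} {p : Fin n → ℝ → ℂ} (hp : ∀ j, Continuous (p j))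
    {w : ℝ → ℂ} (hw : Continuous w) :
    ∫ x in cube n, (Matrix.of fun j i => p j (x i)).det ^ 2 * tensor (fun _ => w) x
      = n.factorial *
        (Matrix.of fun j k : Fin n => ∫ t in (-1 : ℝ)..1, p j t * p k t * w t).det := by
  have h := integral_mul_det_sq_mul_tensor (f := fun _ => 1) continuousOn_const hp hw
  simp only [one_mul, integral_cube_tensor] at h
  rw [h]
  -- For fixed σ the sum over τ is the determinant with permuted rows; the sign of σ cancels, so all
  -- `n!` values of σ contribute equally.
  have hσ : ∀ σ : Equiv.Perm (Fin n), (∑ τ : Equiv.Perm (Fin n),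
        ((Equiv.Perm.sign σ : ℤ) : ℂ) * ((Equiv.Perm.sign τ : ℤ) : ℂ) *
          ∏ i, ∫ t in (-1 : ℝ)..1, p (σ i) t * p (τ i) t * w t)
      = (Matrix.of fun j k : Fin n => ∫ t in (-1 : ℝ)..1, p j t * p k t * w t).det := by
    intro σ
    have h1 := Matrix.det_permute' σ
      (Matrix.of fun j k : Fin n => ∫ t in (-1 : ℝ)..1, p j t * p k t * w t)
    rw [Matrix.det_apply'] at h1
    simp only [Matrix.submatrix_apply, Matrix.of_apply, id] at h1
    simp only [mul_assoc, ← Finset.mul_sum] at h1 ⊢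
    have h2 : ∀ τ : Equiv.Perm (Fin n), ∏ i, ∫ t in (-1 : ℝ)..1, p (σ i) t * (p (τ i) t * w t)
        = ∏ i, ∫ t in (-1 : ℝ)..1, p (τ i) t * (p (σ i) t * w t) := fun τ =>
      Finset.prod_congr rfl fun i _ => intervalIntegral.integral_congr fun t _ => by ring
    simp only [h2, h1]
    rw [← mul_assoc, ← Int.cast_mul, ← Units.val_mul, Int.units_mul_self]
    simp
  simp only [hσ, Finset.sum_const, Finset.card_univ, Fintype.card_perm, Fintype.card_fin,
    nsmul_eq_mul]

/-! ### The two-point basis -/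

/-- The multiplicity of the root `1` of the `j`-th element of the two-point basis. -/
def expOne (N j : ℕ) : ℕ := if j < N then j else N

/-- The multiplicity of the root `-1` of the `j`-th element of the two-point basis. -/
def expNegOne (N j : ℕ) : ℕ := if j < N then N else j - N

/-- The polynomials `(x-1)^j (x+1)^N` and `(x-1)^N (x+1)^j` for `j < N`. -/
noncomputable def twoPoint (N j : ℕ) (z : ℂ) : ℂ := (z - 1) ^ expOne N j * (z + 1) ^ expNegOne N j

/-- Splitting `2 * N` indices into two blocks of size `N`. -/
def splitEquiv (N : ℕ) : Fin N ⊕ Fin N ≃ Fin (2 * N) :=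
  finSumFinEquiv.trans (finCongr (two_mul N).symm)

lemma splitEquiv_inl {N : ℕ} (i : Fin N) : (splitEquiv N (Sum.inl i) : ℕ) = i := by
  simp [splitEquiv]

lemma splitEquiv_inr {N : ℕ} (i : Fin N) : (splitEquiv N (Sum.inr i) : ℕ) = N + i := by
  simp [splitEquiv, add_comm]

lemma expOne_add_expNegOne_lt {N j : ℕ} (hj : j < 2 * N) : expOne N j + expNegOne N j < 2 * N := by
  unfold expOne expNegOne
  split_ifs <;> omega

/-- These are the Taylor coefficients of the basis at 1, with X standing for x - 1. The second block
of rows is divisible by X^N, so the matrix is block triangular. The diagonal blocks are triangular,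
with diagonal entries 2^N and 1 respectively. -/
lemma det_coeff_twoPoint (N : ℕ) :
    (Matrix.of fun j l : Fin (2 * N) => ((Polynomial.X ^ expOne N j
      * (Polynomial.X + Polynomial.C 2) ^ expNegOne N j : Polynomial ℂ)).coeff l).det
      = 2 ^ N ^ 2 := by
  rw [← Matrix.det_submatrix_equiv_self (splitEquiv N)]
  set M := (Matrix.of fun j l : Fin (2 * N) => ((Polynomial.X ^ expOne N j
      * (Polynomial.X + Polynomial.C 2) ^ expNegOne N j : Polynomial ℂ)).coeff l).submatrix
      (splitEquiv N) (splitEquiv N) with hM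
  have hM1 : ∀ i k, M (Sum.inl i) k = ((Polynomial.X ^ (i : ℕ)
      * (Polynomial.X + Polynomial.C 2) ^ N : Polynomial ℂ)).coeff (splitEquiv N k) := by
    intro i k
    simp [hM, splitEquiv_inl, expOne, expNegOne]
  have hM2 : ∀ i k, M (Sum.inr i) k = ((Polynomial.X ^ N
      * (Polynomial.X + Polynomial.C 2) ^ (i : ℕ) : Polynomial ℂ)).coeff (splitEquiv N k) := by
    intro i k
    simp [hM, splitEquiv_inr, expOne, expNegOne]
  rw [← Matrix.fromBlocks_toBlocks M]
  have h21 : M.toBlocks₂₁ = 0 := by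
    ext i k
    rw [Matrix.toBlocks₂₁, Matrix.of_apply, hM2, splitEquiv_inl, Polynomial.coeff_X_pow_mul',
      if_neg (by omega)]
    rfl
  rw [h21, Matrix.det_fromBlocks_zero₂₁, Matrix.det_of_isUpperTriangular,
    Matrix.det_of_isLowerTriangular]
  · have h1 : ∀ i, M.toBlocks₁₁ i i = 2 ^ N := by
      intro i
      rw [Matrix.toBlocks₁₁, Matrix.of_apply, hM1, splitEquiv_inl, Polynomial.coeff_X_pow_mul',
        if_pos le_rfl, Nat.sub_self, Polynomial.coeff_X_add_C_pow]
      simp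
    have h2 : ∀ i, M.toBlocks₂₂ i i = 1 := by
      intro i
      rw [Matrix.toBlocks₂₂, Matrix.of_apply, hM2, splitEquiv_inr, Polynomial.coeff_X_pow_mul',
        if_pos (by omega), Nat.add_sub_cancel_left, Polynomial.coeff_X_add_C_pow]
      simp
    simp [h1, h2, ← pow_mul, sq]
  · intro i k hik
    rw [Matrix.toBlocks₂₂, Matrix.of_apply, hM2, splitEquiv_inr, Polynomial.coeff_X_pow_mul',
      if_pos (by omega), Nat.add_sub_cancel_left, Polynomial.coeff_X_add_C_pow]
    have : (i : ℕ) < k := hik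
    rw [Nat.choose_eq_zero_of_lt this]
    simp
  · intro i k hik
    have : (k : ℕ) < i := hik
    rw [Matrix.toBlocks₁₁, Matrix.of_apply, hM1, splitEquiv_inl, Polynomial.coeff_X_pow_mul',
      if_neg (by omega)]

/-- The generalized Vandermonde determinant of the two-point basis. -/
theorem det_twoPoint (N : ℕ) (x : Fin (2 * N) → ℂ) :
    (Matrix.of fun j i : Fin (2 * N) => twoPoint N j (x i)).det
      = 2 ^ N ^ 2 * (Matrix.vandermonde x).det := by
  -- The basis is evaluated through its expansion in powers of x - 1; translating the nodes leaves
  -- the Vandermonde determinant unchanged.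
  have h : (Matrix.of fun j i : Fin (2 * N) => twoPoint N j (x i))
      = (Matrix.of fun j l : Fin (2 * N) => ((Polynomial.X ^ expOne N j
      * (Polynomial.X + Polynomial.C 2) ^ expNegOne N j : Polynomial ℂ)).coeff l)
        * (Matrix.vandermonde fun i => x i - 1).transpose := by
    ext j i
    simp only [Matrix.mul_apply, Matrix.of_apply, Matrix.transpose_apply, Matrix.vandermonde_apply]
    set Q : Polynomial ℂ := Polynomial.X ^ expOne N j
      * (Polynomial.X + Polynomial.C 2) ^ expNegOne N j with hQ
    have hdeg : Q.natDegree < 2 * N := by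
      refine lt_of_le_of_lt ?_ (expOne_add_expNegOne_lt j.2)
      rw [hQ]
      refine Polynomial.natDegree_mul_le.trans (add_le_add ?_ ?_)
      · simp
      · refine Polynomial.natDegree_pow_le.trans ?_
        rw [Polynomial.natDegree_X_add_C, mul_one]
    rw [Finset.sum_range (n := 2 * N) (fun l => Q.coeff l * (x i - 1) ^ l) |>.symm,
      ← Polynomial.eval_eq_sum_range' hdeg, hQ]
    simp only [twoPoint, Polynomial.eval_mul, Polynomial.eval_pow, Polynomial.eval_add,
      Polynomial.eval_X, Polynomial.eval_C]
    ring
  rw [h, Matrix.det_mul, det_coeff_twoPoint, Matrix.det_transpose, Matrix.det_vandermonde_sub]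

/-! ### The symmetric integral through determinants -/

lemma det_vandermonde_sq {n : ℕ} (x : Fin n → ℝ) :
    (Matrix.vandermonde fun i => (x i : ℂ)).det ^ 2 = (vandermondeSq x : ℂ) := by
  rw [Matrix.det_vandermonde, vandermondeSq]
  push_cast
  simp only [Finset.prod_pow]

lemma exp_sum_eq_tensor {n : ℕ} (ω : ℝ) (x : Fin n → ℝ) :
    Complex.exp (Complex.I * (ω : ℂ) * ((∑ i, x i : ℝ) : ℂ))
      = tensor (fun _ t => Complex.exp (Complex.I * (ω : ℂ) * (t : ℂ))) x := by
  rw [tensor, ← Complex.exp_sum, Complex.ofReal_sum, Finset.mul_sum]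

lemma continuous_exp_I_mul (ω : ℝ) :
    Continuous fun t : ℝ => Complex.exp (Complex.I * (ω : ℂ) * (t : ℂ)) := by
  fun_prop

/-- Andréief's identity in the monomial basis. -/
lemma symmetricIntegral_one (n : ℕ) (ω : ℝ) :
    symmetricIntegral n (fun _ => 1) ω
      = (Matrix.of fun i j : Fin n => moment (i.val + j.val) ω).det := by
  have h := integral_det_sq_mul_tensor (n := n) (p := fun j t => (t : ℂ) ^ (j : ℕ))
    (fun j => by fun_prop) (continuous_exp_I_mul ω)
  have hm : (Matrix.of fun j k : Fin n => ∫ t in (-1 : ℝ)..1, (t : ℂ) ^ (j : ℕ) * (t : ℂ) ^ (k : ℕ)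
      * Complex.exp (Complex.I * (ω : ℂ) * (t : ℂ)))
      = Matrix.of fun i j : Fin n => moment (i.val + j.val) ω := by
    ext j k
    simp only [Matrix.of_apply, moment, pow_add]
  rw [hm] at h
  have hI : (∫ x in cube n, (1 : ℂ) * (vandermondeSq x : ℂ) *
      Complex.exp (Complex.I * (ω : ℂ) * ((∑ i, x i : ℝ) : ℂ)))
      = n.factorial * (Matrix.of fun i j : Fin n => moment (i.val + j.val) ω).det := by
    rw [← h]
    refine setIntegral_congr_fun (measurableSet_cube n) fun x _ => ?_
    simp only [exp_sum_eq_tensor]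
    rw [one_mul, ← det_vandermonde_sq, ← Matrix.det_transpose]
    rfl
  rw [symmetricIntegral, hI, ← mul_assoc, one_div,
    inv_mul_cancel₀ (by exact_mod_cast n.factorial_ne_zero), one_mul]

lemma continuous_twoPoint (N j : ℕ) : Continuous fun t : ℝ => twoPoint N j t := by
  unfold twoPoint
  fun_prop

lemma vandermondeSq_mul_exp (N : ℕ) (ω : ℝ) (x : Fin (2 * N) → ℝ) :
    4 ^ N ^ 2 * ((vandermondeSq x : ℂ) * Complex.exp (Complex.I * (ω : ℂ) * ((∑ i, x i : ℝ) : ℂ)))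
      = (Matrix.of fun j i : Fin (2 * N) => twoPoint N j (x i)).det ^ 2
        * tensor (fun _ t => Complex.exp (Complex.I * (ω : ℂ) * (t : ℂ))) x := by
  rw [det_twoPoint, mul_pow, det_vandermonde_sq, exp_sum_eq_tensor, ← pow_mul, mul_comm (N ^ 2) 2,
    pow_mul]
  norm_num
  ring

lemma twoPoint_mul_twoPoint_mul_exp (N j k : ℕ) (ω t : ℝ) :
    twoPoint N j t * twoPoint N k t * Complex.exp (Complex.I * (ω : ℂ) * (t : ℂ))
      = endpointKernel (expOne N j + expOne N k) (expNegOne N j + expNegOne N k) ω t := by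
  unfold twoPoint endpointKernel
  ring

/-- The symmetric integral as a sum over pairs of permutations of integrals of products. -/
lemma symmetricIntegral_eq_sum {N : ℕ} {f : (Fin (2 * N) → ℝ) → ℂ}
    (hf : ContinuousOn f (cube (2 * N))) (ω : ℝ) :
    4 ^ N ^ 2 * ((2 * N).factorial * symmetricIntegral (2 * N) f ω)
      = ∑ σ : Equiv.Perm (Fin (2 * N)), ∑ τ : Equiv.Perm (Fin (2 * N)),
        ((Equiv.Perm.sign σ : ℤ) : ℂ) * ((Equiv.Perm.sign τ : ℤ) : ℂ) *
          ∫ x in cube (2 * N), f x * tensor (fun i => endpointKernel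
            (expOne N (σ i) + expOne N (τ i)) (expNegOne N (σ i) + expNegOne N (τ i)) ω) x := by
  have h := integral_mul_det_sq_mul_tensor hf (p := fun j t => twoPoint N j t)
    (fun j => continuous_twoPoint N j) (continuous_exp_I_mul ω)
  simp only [twoPoint_mul_twoPoint_mul_exp] at h
  rw [← h, symmetricIntegral, ← mul_assoc _ _ (∫ x in cube (2 * N), _), one_div,
    mul_inv_cancel₀ (by exact_mod_cast (2 * N).factorial_ne_zero), one_mul, ← integral_const_mul]
  refine setIntegral_congr_fun (measurableSet_cube _) fun x _ => ?_
  rw [← vandermondeSq_mul_exp]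
  ring

lemma symmetricIntegral_one_eq_det (N : ℕ) (ω : ℝ) :
    4 ^ N ^ 2 * symmetricIntegral (2 * N) (fun _ => 1) ω
      = (Matrix.of fun j k : Fin (2 * N) => ∫ t in (-1 : ℝ)..1, endpointKernel
        (expOne N j + expOne N k) (expNegOne N j + expNegOne N k) ω t).det := by
  have h := integral_det_sq_mul_tensor (n := 2 * N) (p := fun j t => twoPoint N j t)
    (fun j => continuous_twoPoint N j) (continuous_exp_I_mul ω)
  simp only [twoPoint_mul_twoPoint_mul_exp] at h
  have hfac : ((2 * N).factorial : ℂ) ≠ 0 := by exact_mod_cast (2 * N).factorial_ne_zero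
  rw [← mul_right_inj' hfac, ← h, symmetricIntegral, ← mul_assoc, ← mul_assoc, one_div,
    mul_comm (_ * _) (_⁻¹), ← mul_assoc, inv_mul_cancel₀ hfac, one_mul, ← integral_const_mul]
  refine setIntegral_congr_fun (measurableSet_cube _) fun x _ => ?_
  rw [← vandermondeSq_mul_exp]
  ring

/-! ### Leading terms of one-dimensional integrals -/

theorem isBigO_intervalIntegral_of_kernelOrder {d : ℕ} {k : ℝ → ℝ → ℂ} (hk : KernelOrder d k) :
    (fun ω => ∫ t in (-1 : ℝ)..1, k ω t) =O[atTop] fun ω : ℝ => (ω ^ d)⁻¹ := by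
  have h := isBigO_integral_mul_tensor d (n := 1) (fun _ => 1) (fun _ => k) (fun _ => d)
    contDiffOn_const (fun _ => hk) (by simp)
  refine h.congr_left fun ω => ?_
  simp only [one_mul, integral_cube_tensor, Finset.univ_unique, Finset.prod_singleton]

lemma intervalIntegrable_oscKernel (φ : Polynomial ℂ) (m : ℕ) (ω : ℝ) :
    IntervalIntegrable (oscKernel φ m ω) volume (-1) 1 :=
  (contDiff_oscKernel φ m ω (l := 0)).continuous.intervalIntegrable _ _

lemma mul_integral_oscKernel_zero (φ : Polynomial ℂ) (ω : ℝ) :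
    (ω : ℂ) * ∫ t in (-1 : ℝ)..1, oscKernel φ 0 ω t
      = -Complex.I * (oscKernel φ 0 ω 1 - oscKernel φ 0 ω (-1))
        + Complex.I * ∫ t in (-1 : ℝ)..1, oscKernel φ.derivative 0 ω t := by
  have h := intervalIntegral.integral_eq_sub_of_hasDerivAt
    (fun t _ => hasDerivAt_oscKernel_zero φ ω t)
    (((intervalIntegrable_oscKernel φ 0 ω).const_mul _).add
      (intervalIntegrable_oscKernel φ.derivative 0 ω))
  rw [intervalIntegral.integral_add ((intervalIntegrable_oscKernel φ 0 ω).const_mul _)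
    (intervalIntegrable_oscKernel φ.derivative 0 ω), intervalIntegral.integral_const_mul] at h
  rw [← h]
  linear_combination ((ω : ℂ) * ∫ t in (-1 : ℝ)..1, oscKernel φ 0 ω t) * Complex.I_mul_I

lemma mul_integral_oscKernel_succ (φ : Polynomial ℂ) (m : ℕ) (ω : ℝ) :
    (ω : ℂ) * ∫ t in (-1 : ℝ)..1, oscKernel φ (m + 1) ω t
      = Complex.I * ∫ t in (-1 : ℝ)..1, oscKernel (φ.derivative * (Polynomial.X ^ 2 - 1)
          + ((2 * (m + 1) : ℕ) : Polynomial ℂ) * Polynomial.X * φ) m ω t := by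
  have h := intervalIntegral.integral_eq_sub_of_hasDerivAt
    (fun t _ => hasDerivAt_oscKernel_succ φ m ω t)
    (((intervalIntegrable_oscKernel φ (m + 1) ω).const_mul _).add
      (intervalIntegrable_oscKernel _ m ω))
  rw [intervalIntegral.integral_add ((intervalIntegrable_oscKernel φ (m + 1) ω).const_mul _)
    (intervalIntegrable_oscKernel _ m ω), intervalIntegral.integral_const_mul] at h
  have h0 : oscKernel φ (m + 1) ω 1 - oscKernel φ (m + 1) ω (-1) = 0 := by simp [oscKernel]
  rw [h0] at h
  linear_combination (-Complex.I) * h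
    + ((ω : ℂ) * ∫ t in (-1 : ℝ)..1, oscKernel φ (m + 1) ω t) * Complex.I_mul_I

/-- Leading asymptotics of an oscillatory integral governed by the endpoint `p`. -/
theorem isBigO_integral_oscKernel_sub {p : ℝ} (hp : p = 1 ∨ p = -1) (m : ℕ) : ∀ φ : Polynomial ℂ,
    (fun ω : ℝ => (∫ t in (-1 : ℝ)..1, oscKernel (φ * (Polynomial.X + Polynomial.C (p : ℂ))) m ω t)
      - p * -Complex.I * Complex.I ^ m * m.factorial * (2 * p) ^ (m + 1) * φ.eval (p : ℂ)
        * Complex.exp (Complex.I * ω * p) / (ω : ℂ) ^ (m + 1))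
      =O[atTop] fun ω : ℝ => (ω ^ (m + 2))⁻¹ := by
  induction m with
  | zero =>
    intro φ
    set ψ := φ * (Polynomial.X + Polynomial.C (p : ℂ)) with hψ
    refine isBigO_inv_pow_succ_of_mul (((isBigO_intervalIntegral_of_kernelOrder
      (kernelOrder_oscKernel 0 ψ.derivative)).const_mul_left Complex.I).congr' ?_ EventuallyEq.rfl)
    filter_upwards [eventually_gt_atTop 0] with ω hω
    have hω' : (ω : ℂ) ≠ 0 := by exact_mod_cast hω.ne'
    have hb : oscKernel ψ 0 ω 1 - oscKernel ψ 0 ω (-1)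
        = p * (2 * p) * φ.eval (p : ℂ) * Complex.exp (Complex.I * ω * p) := by
      rcases hp with rfl | rfl <;> simp [oscKernel, hψ] <;> ring
    rw [mul_sub, mul_integral_oscKernel_zero, hb]
    simp only [zero_add, pow_one, pow_zero, Nat.factorial_zero]
    field_simp
    push_cast
    ring
  | succ m ih =>
    intro φ
    set ψ := φ * (Polynomial.X + Polynomial.C (p : ℂ)) with hψ
    -- The factor X + p, which removes the contribution of the endpoint -p, must survive the
    -- integration by parts; φ₁ is the cofactor, obtained from X² - 1 = (X - p)(X + p).
    set φ₁ := ψ.derivative * (Polynomial.X - Polynomial.C (p : ℂ))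
      + ((2 * (m + 1) : ℕ) : Polynomial ℂ) * Polynomial.X * φ with hφ₁
    have hpp : (Polynomial.C (p : ℂ)) ^ 2 = 1 := by
      rcases hp with rfl | rfl <;> simp
    have hE : ψ.derivative * (Polynomial.X ^ 2 - 1)
          + ((2 * (m + 1) : ℕ) : Polynomial ℂ) * Polynomial.X * ψ
        = φ₁ * (Polynomial.X + Polynomial.C (p : ℂ)) := by
      rw [hφ₁]
      linear_combination ((2 * (m + 1) : ℕ) : Polynomial ℂ) * Polynomial.X * hψ
        + ψ.derivative * hpp
    -- At `p` the derivative term drops out; the factors 2(m+1)p accumulate to the factorial and the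
    -- powers of 2p.
    have hev : φ₁.eval (p : ℂ) = 2 * (m + 1) * p * φ.eval (p : ℂ) := by
      simp [hφ₁]
    refine isBigO_inv_pow_succ_of_mul (((ih φ₁).const_mul_left Complex.I).congr' ?_
      EventuallyEq.rfl)
    filter_upwards [eventually_gt_atTop 0] with ω hω
    have hω' : (ω : ℂ) ≠ 0 := by exact_mod_cast hω.ne'
    rw [mul_sub (ω : ℂ), mul_integral_oscKernel_succ, hE, hev, mul_sub, Nat.factorial_succ]
    congr 1
    push_cast
    field_simp
    ring

lemma isBigO_integral_endpointKernel_one {m M : ℕ} (h : m < M) :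
    (fun ω : ℝ => (∫ t in (-1 : ℝ)..1, endpointKernel m M ω t)
      - -Complex.I * 2 ^ M * (Complex.I ^ m * m.factorial)
        * Complex.exp (Complex.I * ω) / (ω : ℂ) ^ (m + 1))
      =O[atTop] fun ω : ℝ => (ω ^ (m + 2))⁻¹ := by
  obtain ⟨c, rfl⟩ := Nat.exists_eq_add_of_lt h
  refine (isBigO_integral_oscKernel_sub (p := 1) (Or.inl rfl) m
    ((Polynomial.X + 1) ^ c)).congr_left fun ω => ?_
  have := endpointKernel_add 0 (c + 1) m
  rw [add_zero, ← add_assoc] at this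
  rw [this, pow_zero, one_mul]
  congr 1
  · simp only [Complex.ofReal_one, Polynomial.eval_pow, Polynomial.eval_add, Polynomial.eval_X,
      Polynomial.eval_one]
    norm_num
    ring

/-- The endpoint -1 naturally produces (-2)^M; evenness removes the sign. It is applied with M = 2N.
-/
lemma isBigO_integral_endpointKernel_neg_one {m M : ℕ} (h : m < M) (hM : Even M) :
    (fun ω : ℝ => (∫ t in (-1 : ℝ)..1, endpointKernel M m ω t)
      - Complex.I * 2 ^ M * (Complex.I ^ m * m.factorial)
        * Complex.exp (-(Complex.I * ω)) / (ω : ℂ) ^ (m + 1))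
      =O[atTop] fun ω : ℝ => (ω ^ (m + 2))⁻¹ := by
  have h2 : (2 : ℂ) ^ M = (-2) ^ M := (hM.neg_pow 2).symm
  rw [h2]
  clear h2 hM
  obtain ⟨c, rfl⟩ := Nat.exists_eq_add_of_lt h
  refine (isBigO_integral_oscKernel_sub (p := -1) (Or.inr rfl) m
    ((Polynomial.X - 1) ^ c)).congr_left fun ω => ?_
  have := endpointKernel_add (c + 1) 0 m
  rw [add_zero, ← add_assoc] at this
  rw [this, pow_zero, mul_one]
  congr 1
  · simp [pow_succ, sub_eq_add_neg]
  · simp only [Complex.ofReal_one, Polynomial.eval_pow, Polynomial.eval_sub, Polynomial.eval_X,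
      Polynomial.eval_one, Complex.ofReal_neg]
    norm_num
    ring

/-! ### Perturbation of determinants and the factorial Hankel determinant -/

lemma isBigO_prod_sub {ι : Type*} (s : Finset ι) {f : ι → ℝ → ℂ} {c : ι → ℂ} {g : ℝ → ℝ}
    (hg : g =O[atTop] fun _ => (1 : ℝ)) (h : ∀ i ∈ s, (fun ω => f i ω - c i) =O[atTop] g) :
    (fun ω => ∏ i ∈ s, f i ω - ∏ i ∈ s, c i) =O[atTop] g := by
  classical
  induction s using Finset.induction_on with
  | empty => simpa using isBigO_zero g atTop
  | insert a s ha ih =>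
    have h1 := h a (Finset.mem_insert_self a s)
    have h2 := ih fun i hi => h i (Finset.mem_insert_of_mem hi)
    have h3 : (fun ω => ∏ i ∈ s, f i ω) =O[atTop] fun _ => (1 : ℝ) :=
      ((h2.trans hg).add (isBigO_const_const (∏ i ∈ s, c i) one_ne_zero atTop)).congr_left
        fun ω => by ring
    refine (((h1.mul h3).congr_right fun ω => mul_one _).add
      (h2.const_mul_left (c a))).congr_left fun ω => ?_
    rw [Finset.prod_insert ha, Finset.prod_insert ha]
    ring

lemma isBigO_det_sub {ι : Type*} [Fintype ι] [DecidableEq ι] {M : ℝ → Matrix ι ι ℂ}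
    {M₀ : Matrix ι ι ℂ} {g : ℝ → ℝ} (hg : g =O[atTop] fun _ => (1 : ℝ))
    (h : ∀ i j, (fun ω => M ω i j - M₀ i j) =O[atTop] g) :
    (fun ω => (M ω).det - M₀.det) =O[atTop] g := by
  simp only [Matrix.det_apply', ← Finset.sum_sub_distrib, ← mul_sub]
  refine IsBigO.fun_sum fun σ _ => (isBigO_prod_sub _ hg fun i _ => h _ _).const_mul_left _

/-- (i+j)! is i! times the rising factorial (i+1)⋯(i+j), a monic polynomial of degree j in i + 1.
The row factors give one superfactorial and the Vandermonde determinant at consecutive integers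
gives the other. -/
lemma det_factorial_add (M : ℕ) :
    (Matrix.of fun i j : Fin (M + 1) => (((i : ℕ) + j).factorial : ℂ)).det
      = (Nat.superFactorial M : ℂ) ^ 2 := by
  have h := Matrix.det_mul_column (fun i : Fin (M + 1) => ((i : ℕ).factorial : ℂ))
    (Matrix.of fun i j : Fin (M + 1) => (ascPochhammer ℂ j).eval ((i : ℂ) + 1))
  have h1 := Matrix.det_eval_matrixOfPolynomials_eq_det_vandermonde
    (fun i : Fin (M + 1) => (i : ℂ) + 1) (fun j => ascPochhammer ℂ j)
    (fun j => ascPochhammer_natDegree _ _) (fun j => monic_ascPochhammer ℂ j)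
  rw [← h1, Matrix.det_vandermonde_add, Matrix.det_vandermonde_id_eq_superFactorial] at h
  have h2 : ∏ i : Fin (M + 1), ((i : ℕ).factorial : ℂ) = Nat.superFactorial M := by
    rw [← Nat.prod_range_succ_factorial, ← Finset.prod_range fun i => ((i.factorial : ℕ) : ℂ)]
    push_cast
    rfl
  rw [h2] at h
  rw [sq, ← h]
  congr 1
  ext i j
  simp only [Matrix.of_apply]
  rw [← Nat.factorial_mul_ascFactorial]
  push_cast
  rw [← ascPochhammer_nat_eq_ascFactorial, ascPochhammer_eval_cast]
  push_cast
  rfl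

/-- The powers of i come out of rows and columns alike, so they enter the squared determinant as a
fourth power, which is 1. -/
lemma det_I_pow_mul_factorial (M : ℕ) :
    (Matrix.of fun i j : Fin (M + 1) =>
      Complex.I ^ ((i : ℕ) + j) * (((i : ℕ) + j).factorial : ℂ)).det ^ 2
      = (Nat.superFactorial M : ℂ) ^ 4 := by
  have h : (Matrix.of fun i j : Fin (M + 1) =>
      Complex.I ^ ((i : ℕ) + j) * (((i : ℕ) + j).factorial : ℂ))
      = Matrix.of fun i j : Fin (M + 1) => Complex.I ^ (i : ℕ) *
        (Matrix.of fun i j : Fin (M + 1) => Complex.I ^ (j : ℕ) *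
          (Matrix.of fun i j : Fin (M + 1) => (((i : ℕ) + j).factorial : ℂ)) i j) i j := by
    ext i j
    simp only [Matrix.of_apply, pow_add]
    ring
  rw [h, Matrix.det_mul_column, Matrix.det_mul_row, det_factorial_add]
  have h4 : (∏ i : Fin (M + 1), Complex.I ^ (i : ℕ)) ^ 4 = 1 := by
    rw [← Finset.prod_pow]
    refine Finset.prod_eq_one fun i _ => ?_
    rw [← pow_mul, mul_comm, pow_mul, Complex.I_pow_four, one_pow]
  linear_combination (Nat.superFactorial M : ℂ) ^ 4 * h4

lemma isBigO_inv_pow_of_le {a b : ℕ} (h : a ≤ b) :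
    (fun ω : ℝ => (ω ^ b)⁻¹) =O[atTop] fun ω : ℝ => (ω ^ a)⁻¹ := by
  refine IsBigO.of_bound 1 ?_
  filter_upwards [eventually_ge_atTop 1] with ω hω
  have h0 : 0 < ω := by linarith
  rw [one_mul, norm_inv, norm_inv, norm_pow, norm_pow, Real.norm_of_nonneg h0.le]
  gcongr

lemma isBigO_pow_mul_of_isBigO {f ph : ℝ → ℂ} {D q : ℕ}
    (hf : f =O[atTop] fun ω : ℝ => (ω ^ D)⁻¹) (hph : ∀ ω, ‖ph ω‖ = 1) (h : q + 1 ≤ D) :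
    (fun ω : ℝ => (ω : ℂ) ^ q * ph ω * f ω) =O[atTop] fun ω : ℝ => ω⁻¹ := by
  have h1 : (fun ω : ℝ => (ω : ℂ) ^ q * ph ω) =O[atTop] fun ω : ℝ => ω ^ q :=
    IsBigO.of_bound 1 (Eventually.of_forall fun ω => by simp [hph])
  refine (h1.mul (hf.trans (isBigO_inv_pow_of_le h))).congr' EventuallyEq.rfl ?_
  filter_upwards [eventually_gt_atTop 0] with ω hω
  field_simp
  ring

lemma isBigO_pow_mul_sub {f ph E : ℝ → ℂ} {c : ℂ} {m : ℕ}
    (hf : (fun ω : ℝ => f ω - c * E ω / (ω : ℂ) ^ (m + 1)) =O[atTop] fun ω : ℝ => (ω ^ (m + 2))⁻¹)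
    (hph : ∀ ω, ‖ph ω‖ = 1) (hE : ∀ ω, ph ω * E ω = 1) :
    (fun ω : ℝ => (ω : ℂ) ^ (m + 1) * ph ω * f ω - c) =O[atTop] fun ω : ℝ => ω⁻¹ := by
  refine (isBigO_pow_mul_of_isBigO hf hph le_rfl).congr' ?_ EventuallyEq.rfl
  filter_upwards [eventually_gt_atTop 0] with ω hω
  have hω' : (ω : ℂ) ≠ 0 := by exact_mod_cast hω.ne'
  field_simp
  linear_combination (-c) * hE ω

lemma norm_exp_I_mul_ofReal (ω : ℝ) : ‖Complex.exp (Complex.I * ω)‖ = 1 := by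
  simpa only [Complex.ofReal_one, mul_one] using norm_exp_I_mul ω 1

lemma norm_exp_neg_I_mul_ofReal (ω : ℝ) : ‖Complex.exp (-(Complex.I * ω))‖ = 1 := by
  simpa using norm_exp_I_mul ω (-1)

/-! ### The rescaled moment matrix and its limit -/

/-- The phase by which a row of the two-point moment matrix is rescaled. -/
noncomputable def rowPhase (N : ℕ) (a : Fin N ⊕ Fin N) (ω : ℝ) : ℂ :=
  Sum.elim (fun _ => Complex.exp (-(Complex.I * ω))) (fun _ => Complex.exp (Complex.I * ω)) a

/-- The position of an index inside its block. -/
def blockIndex (N : ℕ) (a : Fin N ⊕ Fin N) : ℕ := Sum.elim (fun i : Fin N => (i : ℕ)) (fun i : Fin N => (i : ℕ)) a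

/-- The moment matrix of the two-point basis. -/
noncomputable def twoPointMoments (N : ℕ) (ω : ℝ) : Matrix (Fin N ⊕ Fin N) (Fin N ⊕ Fin N) ℂ :=
  Matrix.of fun a b => ∫ t in (-1 : ℝ)..1, endpointKernel
    (expOne N (splitEquiv N a) + expOne N (splitEquiv N b))
    (expNegOne N (splitEquiv N a) + expNegOne N (splitEquiv N b)) ω t

lemma expOne_inl {N : ℕ} (i : Fin N) : expOne N (splitEquiv N (Sum.inl i)) = i := by
  simp [splitEquiv_inl, expOne]

lemma expOne_inr {N : ℕ} (i : Fin N) : expOne N (splitEquiv N (Sum.inr i)) = N := by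
  simp [splitEquiv_inr, expOne]

lemma expNegOne_inl {N : ℕ} (i : Fin N) : expNegOne N (splitEquiv N (Sum.inl i)) = N := by
  simp [splitEquiv_inl, expNegOne]

lemma expNegOne_inr {N : ℕ} (i : Fin N) : expNegOne N (splitEquiv N (Sum.inr i)) = i := by
  simp [splitEquiv_inr, expNegOne]

/-- The rescaled limit of one diagonal block. -/
noncomputable def limitBlock (N : ℕ) : Matrix (Fin N) (Fin N) ℂ :=
  Matrix.of fun i j => Complex.I ^ ((i : ℕ) + j) * (((i : ℕ) + j).factorial : ℂ)

lemma isBigO_twoPointMoments_sub (N : ℕ) (a b : Fin N ⊕ Fin N) :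
    (fun ω : ℝ => (ω : ℂ) ^ (blockIndex N a + blockIndex N b + 1) * rowPhase N a ω
        * twoPointMoments N ω a b
      - Matrix.fromBlocks ((-Complex.I * 2 ^ (2 * N)) • limitBlock N) 0 0
          ((Complex.I * 2 ^ (2 * N)) • limitBlock N) a b) =O[atTop] fun ω : ℝ => ω⁻¹ := by
  have h1 : ∀ ω : ℝ, Complex.exp (-(Complex.I * ω)) * Complex.exp (Complex.I * ω) = 1 := fun ω => by
    rw [← Complex.exp_add]; simp
  have h2 : ∀ ω : ℝ, Complex.exp (Complex.I * ω) * Complex.exp (-(Complex.I * ω)) = 1 := fun ω => by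
    rw [← Complex.exp_add]; simp
  rcases a with i | i <;> rcases b with j | j <;>
    simp only [twoPointMoments, Matrix.of_apply, expOne_inl, expOne_inr, expNegOne_inl,
      expNegOne_inr, rowPhase, blockIndex, Sum.elim_inl, Sum.elim_inr, Matrix.fromBlocks_apply₁₁,
      Matrix.fromBlocks_apply₁₂, Matrix.fromBlocks_apply₂₁, Matrix.fromBlocks_apply₂₂,
      Matrix.smul_apply, smul_eq_mul, limitBlock, ← two_mul N, Matrix.zero_apply, sub_zero]
  · exact isBigO_pow_mul_sub (isBigO_integral_endpointKernel_one (m := i + j) (M := 2 * N)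
      (by omega)) norm_exp_neg_I_mul_ofReal h1
  -- Off-diagonal entries have order N + min(i,j) + 1, which beats the scaling exponent i + j + 1
  -- because max(i,j) < N; they vanish in the limit.
  · refine isBigO_pow_mul_of_isBigO (isBigO_intervalIntegral_of_kernelOrder
      (kernelOrder_endpointKernel _ _)) norm_exp_neg_I_mul_ofReal ?_
    omega
  · refine isBigO_pow_mul_of_isBigO (isBigO_intervalIntegral_of_kernelOrder
      (kernelOrder_endpointKernel _ _)) norm_exp_I_mul_ofReal ?_
    omega
  · exact isBigO_pow_mul_sub (isBigO_integral_endpointKernel_neg_one (m := i + j) (M := 2 * N)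
      (by omega) (even_two_mul N)) norm_exp_I_mul_ofReal h2

lemma two_mul_sum_fin_add (N : ℕ) : 2 * (∑ i : Fin N, (i : ℕ)) + N = N ^ 2 := by
  rw [Fin.sum_univ_eq_sum_range (fun i => i), mul_comm, Finset.sum_range_id_mul_two]
  cases N with
  | zero => rfl
  | succ n => simp; ring

/-- The blocks have equal size, so the opposite phases cancel; hence the leading term of the
determinant does not oscillate. -/
lemma prod_rowPhase (N : ℕ) (ω : ℝ) : ∏ a, rowPhase N a ω = 1 := by
  rw [Fintype.prod_sum_type]
  simp only [rowPhase, Sum.elim_inl, Sum.elim_inr, Finset.prod_const, ← mul_pow, ← Complex.exp_add]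
  simp

lemma sum_blockIndex (N : ℕ) : 2 * (∑ a, blockIndex N a) + 2 * N = 2 * N ^ 2 := by
  rw [Fintype.sum_sum_type]
  simp only [blockIndex, Sum.elim_inl, Sum.elim_inr]
  have := two_mul_sum_fin_add N
  omega

lemma det_rescaled_twoPointMoments (N : ℕ) (ω : ℝ) :
    (Matrix.of fun a b => (ω : ℂ) ^ (blockIndex N a + blockIndex N b + 1) * rowPhase N a ω
        * twoPointMoments N ω a b).det = (ω : ℂ) ^ (2 * N ^ 2) * (twoPointMoments N ω).det := by
  have h : (Matrix.of fun a b => (ω : ℂ) ^ (blockIndex N a + blockIndex N b + 1) * rowPhase N a ω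
        * twoPointMoments N ω a b)
      = Matrix.of fun a b => ((ω : ℂ) ^ (blockIndex N a + 1) * rowPhase N a ω) *
        (Matrix.of fun a b => (ω : ℂ) ^ blockIndex N b * twoPointMoments N ω a b) a b := by
    ext a b
    simp only [Matrix.of_apply]
    ring
  rw [h, Matrix.det_mul_column, Matrix.det_mul_row, Finset.prod_mul_distrib, prod_rowPhase, mul_one,
    Finset.prod_pow_eq_pow_sum, Finset.prod_pow_eq_pow_sum, ← mul_assoc, ← pow_add]
  congr 2
  rw [Finset.sum_add_distrib, ← sum_blockIndex]
  simp
  ring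

lemma det_twoPointMoments (N : ℕ) (ω : ℝ) :
    (twoPointMoments N ω).det = 4 ^ N ^ 2 * symmetricIntegral (2 * N) (fun _ => 1) ω := by
  rw [symmetricIntegral_one_eq_det, ← Matrix.det_submatrix_equiv_self (splitEquiv N)]
  rfl

/-- Asymptotics of the symmetric integral of the constant function `1`. -/
theorem isBigO_symmetricIntegral_one_sub {N : ℕ} (hN : 1 ≤ N) :
    (fun ω : ℝ => symmetricIntegral (2 * N) (fun _ => 1) ω
      - (4 : ℂ) ^ (N ^ 2) / (ω : ℂ) ^ (2 * N ^ 2) * (Nat.superFactorial (N - 1) : ℂ) ^ 4)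
      =O[atTop] fun ω : ℝ => (ω ^ (2 * N ^ 2 + 1))⁻¹ := by
  obtain ⟨M, rfl⟩ := Nat.exists_eq_add_of_le' hN
  set N := M + 1 with hNdef
  have hinv : (fun ω : ℝ => ω⁻¹) =O[atTop] fun _ => (1 : ℝ) := by
    simpa using isBigO_inv_pow_of_le (Nat.zero_le 1)
  have h := isBigO_det_sub hinv (M := fun ω : ℝ => Matrix.of fun a b =>
    (ω : ℂ) ^ (blockIndex N a + blockIndex N b + 1) * rowPhase N a ω * twoPointMoments N ω a b)
    (isBigO_twoPointMoments_sub N)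
  -- Since (-i)·i = 1, the two blocks together give 4^(2N²). One factor 4^(N²) is later cancelled by
  -- the change of basis.
  have hdet0 : (Matrix.fromBlocks ((-Complex.I * 2 ^ (2 * N)) • limitBlock N) 0 0
          ((Complex.I * 2 ^ (2 * N)) • limitBlock N)).det
      = (4 : ℂ) ^ (N ^ 2) * (4 ^ (N ^ 2) * (Nat.superFactorial M : ℂ) ^ 4) := by
    rw [Matrix.det_fromBlocks_zero₂₁, Matrix.det_smul, Matrix.det_smul, Fintype.card_fin,
      ← det_I_pow_mul_factorial, ← limitBlock]
    have h5 : ∀ z : ℂ, -Complex.I * z * (Complex.I * z) = z * z := fun z => by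
      linear_combination (-z * z) * Complex.I_mul_I
    have h1 : (-Complex.I * 2 ^ (2 * N)) ^ N * (Complex.I * 2 ^ (2 * N)) ^ N
        = 4 ^ N ^ 2 * 4 ^ N ^ 2 := by
      rw [← mul_pow, ← mul_pow, sq N, pow_mul _ N N]
      congr 1
      rw [pow_mul, show (2 : ℂ) ^ 2 = 4 by norm_num]
      exact (h5 _).trans (mul_pow _ _ _).symm
    linear_combination (limitBlock N).det ^ 2 * h1
  simp only [det_rescaled_twoPointMoments, hdet0, det_twoPointMoments] at h
  have h4 : ((4 : ℂ) ^ N ^ 2) ≠ 0 := pow_ne_zero _ (by norm_num)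
  have hpow : (fun ω : ℝ => ((ω : ℂ) ^ (2 * N ^ 2))⁻¹) =O[atTop]
      fun ω : ℝ => (ω ^ (2 * N ^ 2))⁻¹ :=
    IsBigO.of_bound 1 (Eventually.of_forall fun ω => by simp)
  refine ((hpow.mul h).const_mul_left ((4 : ℂ) ^ N ^ 2)⁻¹).congr' ?_
    (Eventually.of_forall fun ω => ?_)
  · filter_upwards [eventually_gt_atTop 0] with ω hω
    have hω' : (ω : ℂ) ≠ 0 := by exact_mod_cast hω.ne'
    have hM : N - 1 = M := by omega
    rw [hM]
    field_simp
  · beta_reduce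
    rw [pow_succ _ (2 * N ^ 2), mul_inv]

/-! ### General integrands: concentration at vertices of weight zero -/

lemma card_filter_perm_lt (N : ℕ) (σ : Equiv.Perm (Fin (2 * N))) :
    (Finset.univ.filter fun i => (σ i : ℕ) < N).card = N := by
  rw [Finset.card_filter, Equiv.sum_comp σ (fun j => if (j : ℕ) < N then 1 else 0),
    ← Equiv.sum_comp (splitEquiv N), Fintype.sum_sum_type]
  simp [splitEquiv_inl, splitEquiv_inr]

/-- The vertex of the cube at which the product indexed by the permutation `σ` concentrates. -/
noncomputable def permVertex (N : ℕ) (σ : Equiv.Perm (Fin (2 * N))) (i : Fin (2 * N)) : ℝ :=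
  if (σ i : ℕ) < N then 1 else -1

lemma isVertex_permVertex (N : ℕ) (σ : Equiv.Perm (Fin (2 * N))) : IsVertex (permVertex N σ) := by
  intro i
  unfold permVertex
  split_ifs <;> simp

lemma weight_permVertex (N : ℕ) (σ : Equiv.Perm (Fin (2 * N))) : weight (permVertex N σ) = 0 := by
  have h1 : (Finset.univ.filter fun i => permVertex N σ i = 1)
      = Finset.univ.filter fun i => (σ i : ℕ) < N := by
    refine Finset.filter_congr fun i _ => ?_
    unfold permVertex
    split_ifs with h
    · simp [h]
    · simp only [h, iff_false]; norm_num
  have h2 : (Finset.univ.filter fun i => permVertex N σ i = -1)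
      = Finset.univ.filter fun i => ¬ (σ i : ℕ) < N := by
    refine Finset.filter_congr fun i _ => ?_
    unfold permVertex
    split_ifs with h
    · simp only [h, not_true, iff_false]; norm_num
    · simp [h]
  have h3 := Finset.card_filter_add_card_filter_not (s := (Finset.univ : Finset (Fin (2 * N))))
    (fun i => (σ i : ℕ) < N)
  rw [card_filter_perm_lt, Finset.card_univ, Fintype.card_fin] at h3
  rw [weight, h1, h2, card_filter_perm_lt, abs_eq_zero]
  omega

lemma sum_min_exp (N : ℕ) (σ : Equiv.Perm (Fin (2 * N))) :
    2 * (∑ i, min (expOne N (σ i)) (expNegOne N (σ i))) + 2 * N = 2 * N ^ 2 := by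
  rw [Equiv.sum_comp σ (fun j => min (expOne N j) (expNegOne N j)),
    ← Equiv.sum_comp (splitEquiv N), Fintype.sum_sum_type]
  simp only [expOne_inl, expOne_inr, expNegOne_inl, expNegOne_inr]
  have h1 : ∀ i : Fin N, min (i : ℕ) N = i := fun i => min_eq_left i.2.le
  have h2 : ∀ i : Fin N, min N (i : ℕ) = i := fun i => min_eq_right i.2.le
  simp only [h1, h2]
  have := two_mul_sum_fin_add N
  omega

/-- By superadditivity of min, the total order is at least 2N². If σ and τ induce the same blocks,
the term concentrates at a weight-0 vertex and the vanishing of `g` there gains one order. Otherwise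
superadditivity is strict at a coordinate where the blocks differ, and the extra order comes without
using that vanishing. -/
lemma isBigO_integral_perm_of_vanish {N : ℕ} {g : (Fin (2 * N) → ℝ) → ℂ}
    (hg : ContDiffOn ℝ ((⊤ : ℕ∞) : WithTop ℕ∞) g (cube (2 * N)))
    (h0 : ∀ v, IsVertex v → weight v = 0 → g v = 0) (σ τ : Equiv.Perm (Fin (2 * N))) :
    (fun ω => ∫ x in cube (2 * N), g x * tensor (fun i => endpointKernel
        (expOne N (σ i) + expOne N (τ i)) (expNegOne N (σ i) + expNegOne N (τ i)) ω) x)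
      =O[atTop] fun ω : ℝ => (ω ^ (2 * N ^ 2 + 1))⁻¹ := by
  have hσ := sum_min_exp N σ
  have hτ := sum_min_exp N τ
  have hsum : ∑ i, (min (expOne N (σ i)) (expNegOne N (σ i))
      + min (expOne N (τ i)) (expNegOne N (τ i)) + 1) = 2 * N ^ 2 := by
    simp only [Finset.sum_add_distrib, Finset.sum_const, Finset.card_univ, Fintype.card_fin,
      smul_eq_mul, mul_one]
    omega
  have hle : ∀ i, min (expOne N (σ i)) (expNegOne N (σ i))
      + min (expOne N (τ i)) (expNegOne N (τ i)) + 1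
      ≤ min (expOne N (σ i) + expOne N (τ i)) (expNegOne N (σ i) + expNegOne N (τ i)) + 1 := by
    intro i
    omega
  by_cases hst : ∀ i, (σ i : ℕ) < N ↔ (τ i : ℕ) < N
  · have h := isBigO_integral_endpointKernel_of_vanish hg
      (h0 _ (isVertex_permVertex N σ) (weight_permVertex N σ))
      (a := fun i => expOne N (σ i) + expOne N (τ i))
      (b := fun i => expNegOne N (σ i) + expNegOne N (τ i)) (fun i => by
        have hi := hst i
        have h1 := (σ i).2
        have h2 := (τ i).2
        unfold permVertex expOne expNegOne
        by_cases hs : (σ i : ℕ) < N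
        · have ht := hi.1 hs
          refine Or.inl ⟨if_pos hs, ?_⟩
          simp only [hs, ht, if_true]
          omega
        · have ht : ¬ (τ i : ℕ) < N := fun ht => hs (hi.2 ht)
          refine Or.inr ⟨if_neg hs, ?_⟩
          simp only [hs, ht, if_false]
          omega)
    refine h.trans (isBigO_inv_pow_of_le (add_le_add ?_ le_rfl))
    rw [← hsum]
    exact Finset.sum_le_sum fun i _ => hle i
  · push Not at hst
    obtain ⟨i, hi⟩ := hst
    refine (isBigO_integral_mul_tensor _ g _ _ hg
      (fun j => kernelOrder_endpointKernel _ _) rfl).trans (isBigO_inv_pow_of_le ?_)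
    rw [← hsum, Nat.succ_le_iff]
    refine Finset.sum_lt_sum (fun j _ => hle j) ⟨i, Finset.mem_univ i, ?_⟩
    have h1 := (σ i).2
    have h2 := (τ i).2
    unfold expOne expNegOne
    split_ifs <;> omega

theorem isBigO_symmetricIntegral_of_vanish {N : ℕ} {g : (Fin (2 * N) → ℝ) → ℂ}
    (hg : ContDiffOn ℝ ((⊤ : ℕ∞) : WithTop ℕ∞) g (cube (2 * N)))
    (h0 : ∀ v, IsVertex v → weight v = 0 → g v = 0) :
    symmetricIntegral (2 * N) g =O[atTop] fun ω : ℝ => (ω ^ (2 * N ^ 2 + 1))⁻¹ := by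
  have h : (fun ω => 4 ^ N ^ 2 * ((2 * N).factorial * symmetricIntegral (2 * N) g ω))
      =O[atTop] fun ω : ℝ => (ω ^ (2 * N ^ 2 + 1))⁻¹ := by
    simp only [symmetricIntegral_eq_sum hg.continuousOn]
    exact IsBigO.fun_sum fun σ _ => IsBigO.fun_sum fun τ _ =>
      (isBigO_integral_perm_of_vanish hg h0 σ τ).const_mul_left _
  refine (h.const_mul_left ((4 : ℂ) ^ N ^ 2 * (2 * N).factorial)⁻¹).congr_left fun ω => ?_
  have hfac : ((2 * N).factorial : ℂ) ≠ 0 := by exact_mod_cast (2 * N).factorial_ne_zero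
  field_simp

lemma IsVertex.mem_cube {n : ℕ} {v : Fin n → ℝ} (hv : IsVertex v) : v ∈ cube n := by
  rw [Kissing.mem_cube]
  intro i
  rcases hv i with h | h <;> rw [h] <;> norm_num

lemma two_mul_card_eq_of_weight_eq_zero {n : ℕ} {v : Fin n → ℝ} (hv : IsVertex v)
    (hw : weight v = 0) : 2 * (Finset.univ.filter fun i => v i = 1).card = n := by
  have h1 : (Finset.univ.filter fun i => v i = -1) = Finset.univ.filter fun i => ¬ v i = 1 := by
    refine Finset.filter_congr fun i _ => ?_
    rcases hv i with h | h <;> rw [h] <;> norm_num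
  have h3 := Finset.card_filter_add_card_filter_not (s := (Finset.univ : Finset (Fin n)))
    (fun i => v i = 1)
  rw [Finset.card_univ, Fintype.card_fin] at h3
  rw [weight, h1, abs_eq_zero] at hw
  omega

/-- Vertices of weight 0 have equally many coordinates +1, so a bijection between these coordinate
sets extends to a permutation carrying one vertex to the other. -/
lemma eq_of_weight_eq_zero {n : ℕ} {f : (Fin n → ℝ) → ℂ} (hf : IsSymmetricOnCube f)
    {v w : Fin n → ℝ} (hv : IsVertex v) (hw : IsVertex w) (hv0 : weight v = 0)
    (hw0 : weight w = 0) : f w = f v := by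
  obtain ⟨e⟩ : Nonempty ({i // w i = 1} ≃ {i // v i = 1}) := by
    rw [← Fintype.card_eq, Fintype.card_subtype, Fintype.card_subtype]
    have h1 := two_mul_card_eq_of_weight_eq_zero hv hv0
    have h2 := two_mul_card_eq_of_weight_eq_zero hw hw0
    omega
  have h : v ∘ e.extendSubtype = w := by
    ext i
    by_cases hi : w i = 1
    · rw [hi]
      exact e.extendSubtype_mem i hi
    · have h1 := e.extendSubtype_not_mem i hi
      rw [(hw i).resolve_right hi]
      exact (hv _).resolve_right h1
  rw [← h]
  exact hf v hv.mem_cube _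

/-- Asymptotics of the symmetric integral in even dimension. -/
theorem isBigO_symmetricIntegral_sub {N : ℕ} (hN : 1 ≤ N) {f : (Fin (2 * N) → ℝ) → ℂ}
    (hf : ContDiffOn ℝ ((⊤ : ℕ∞) : WithTop ℕ∞) f (cube (2 * N))) (hsymm : IsSymmetricOnCube f)
    {v : Fin (2 * N) → ℝ} (hv : IsVertex v) (hv0 : weight v = 0) :
    (fun ω : ℝ => symmetricIntegral (2 * N) f ω
      - (4 : ℂ) ^ (N ^ 2) / (ω : ℂ) ^ (2 * N ^ 2) * f v * (Nat.superFactorial (N - 1) : ℂ) ^ 4)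
      =O[atTop] fun ω : ℝ => (ω ^ (2 * N ^ 2 + 1))⁻¹ := by
  have h1 := isBigO_symmetricIntegral_of_vanish (g := fun x => f x - f v)
    (hf.sub contDiffOn_const) (fun w hw hw0 => by
      rw [eq_of_weight_eq_zero hsymm hv hw hv0 hw0, sub_self])
  have h2 := (isBigO_symmetricIntegral_one_sub hN).const_mul_left (f v)
  refine (h1.add h2).congr_left fun ω => ?_
  have hcont : Continuous fun x : Fin (2 * N) → ℝ => (vandermondeSq x : ℂ) *
      Complex.exp (Complex.I * (ω : ℂ) * ((∑ i, x i : ℝ) : ℂ)) := by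
    unfold vandermondeSq
    fun_prop
  have h3 : symmetricIntegral (2 * N) (fun x => f x - f v) ω
      = symmetricIntegral (2 * N) f ω - f v * symmetricIntegral (2 * N) (fun _ => 1) ω := by
    have hassoc : ∀ F : (Fin (2 * N) → ℝ) → ℂ, symmetricIntegral (2 * N) F ω
        = (1 / ((2 * N).factorial : ℂ)) * ∫ x in cube (2 * N), F x * ((vandermondeSq x : ℂ) *
          Complex.exp (Complex.I * (ω : ℂ) * ((∑ i, x i : ℝ) : ℂ))) := fun F => by
      simp only [symmetricIntegral, mul_assoc]
    rw [hassoc, hassoc, hassoc, mul_left_comm (f v), ← mul_sub, ← integral_const_mul (f v), ← integral_sub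
      (integrableOn_cube_mul hf.continuousOn hcont)
      ((integrableOn_cube_mul continuousOn_const hcont).const_mul _)]
    congr 2
    ext x
    ring
  rw [h3]
  ring

/-! ### Reality and positivity of the Hankel determinant -/

lemma conj_moment (n : ℕ) (ω : ℝ) :
    (starRingEnd ℂ) (moment n ω) = (-1) ^ n * moment n ω := by
  unfold moment
  rw [← intervalIntegral.intervalIntegral_conj]
  have h := intervalIntegral.integral_comp_neg (a := -1) (b := 1)
    (fun x : ℝ => (x : ℂ) ^ n * Complex.exp (Complex.I * (ω : ℂ) * (x : ℂ)))
  rw [neg_neg] at h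
  rw [← h, ← intervalIntegral.integral_const_mul]
  refine intervalIntegral.integral_congr fun x _ => ?_
  simp only [map_mul, map_pow, Complex.conj_ofReal, ← Complex.exp_conj, Complex.conj_I,
    Complex.ofReal_neg]
  rw [← mul_assoc, ← mul_pow]
  congr 2
  · ring
  · ring

/-- Conjugation multiplies row i and column j by (-1)^i and (-1)^j; in the determinant each sign
appears twice, so it is its own conjugate. -/
lemma hankelDet_im (n : ℕ) (ω : ℝ) : (hankelDet n ω).im = 0 := by
  rw [← Complex.conj_eq_iff_im, hankelDet, RingHom.map_det]
  have h : (starRingEnd ℂ).mapMatrix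
      (Matrix.of fun i j : Fin (n + 1) => moment (i.val + j.val) ω)
      = Matrix.of fun i j : Fin (n + 1) => (-1) ^ (i : ℕ) * (Matrix.of fun i j : Fin (n + 1) =>
        (-1) ^ (j : ℕ) * (Matrix.of fun i j : Fin (n + 1) => moment (i.val + j.val) ω) i j) i j := by
    ext i j
    simp only [RingHom.mapMatrix_apply, Matrix.map_apply, Matrix.of_apply, conj_moment, pow_add]
    ring
  rw [h, Matrix.det_mul_column, Matrix.det_mul_row, ← mul_assoc, ← Finset.prod_mul_distrib]
  have h1 : ∀ i : Fin (n + 1), (-1 : ℂ) ^ (i : ℕ) * (-1) ^ (i : ℕ) = 1 := fun i => by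
    rw [← mul_pow]; norm_num
  simp only [h1, Finset.prod_const_one, one_mul]

lemma symmetricIntegral_one_eq_hankelDet {N : ℕ} (hN : 1 ≤ N) (ω : ℝ) :
    symmetricIntegral (2 * N) (fun _ => 1) ω = hankelDet (2 * N - 1) ω := by
  obtain ⟨n, hn⟩ : ∃ n, 2 * N = n + 1 := ⟨2 * N - 1, by omega⟩
  rw [hn, Nat.add_sub_cancel, symmetricIntegral_one, hankelDet]

theorem eventually_hankelDet_re_pos {N : ℕ} (hN : 1 ≤ N) :
    ∀ᶠ ω : ℝ in atTop, 0 < (hankelDet (2 * N - 1) ω).re := by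
  have h := isBigO_symmetricIntegral_one_sub hN
  set c : ℝ := 4 ^ (N ^ 2) * (Nat.superFactorial (N - 1) : ℝ) ^ 4 with hc
  have hcpos : 0 < c := by
    have : 0 < Nat.superFactorial (N - 1) := by
      rw [← Nat.prod_Icc_factorial]
      exact Finset.prod_pos fun i _ => i.factorial_pos
    positivity
  have hp : (fun ω : ℝ => (ω : ℂ) ^ (2 * N ^ 2)) =O[atTop] fun ω : ℝ => ω ^ (2 * N ^ 2) :=
    IsBigO.of_bound 1 (Eventually.of_forall fun ω => by simp)
  have h1 : (fun ω : ℝ => (ω : ℂ) ^ (2 * N ^ 2) * hankelDet (2 * N - 1) ω - (c : ℂ))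
      =O[atTop] fun ω : ℝ => ω⁻¹ := by
    refine (hp.mul h).congr' ?_ ?_
    · filter_upwards [eventually_gt_atTop 0] with ω hω
      have hω' : (ω : ℂ) ≠ 0 := by exact_mod_cast hω.ne'
      rw [symmetricIntegral_one_eq_hankelDet hN, hc]
      push_cast
      field_simp
    · filter_upwards [eventually_gt_atTop 0] with ω hω
      field_simp
      ring
  -- Scaled by ω^(2N²), the determinant tends to the positive constant `c`, so its real part is
  -- eventually positive.
  have h2 : Tendsto (fun ω : ℝ => (ω : ℂ) ^ (2 * N ^ 2) * hankelDet (2 * N - 1) ω) atTop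
      (𝓝 (c : ℂ)) := tendsto_sub_nhds_zero_iff.1 (h1.trans_tendsto tendsto_inv_atTop_zero)
  have h3 := (Complex.continuous_re.tendsto _).comp h2
  filter_upwards [h3.eventually_const_lt (u := 0) (by simpa using hcpos), eventually_gt_atTop 0]
    with ω h4 hω
  have h5 : ((ω : ℂ) ^ (2 * N ^ 2) * hankelDet (2 * N - 1) ω).re
      = ω ^ (2 * N ^ 2) * (hankelDet (2 * N - 1) ω).re := by
    rw [← Complex.ofReal_pow, Complex.re_ofReal_mul]
  rw [Function.comp_apply, h5] at h4
  exact pos_of_mul_pos_right h4 (by positivity)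

/-! ### Orthogonal polynomials from a nonsingular moment matrix -/

lemma integral_eval_mul_pow_mul_exp {n : ℕ} {p : Polynomial ℂ} (hp : p.natDegree < n) (k : ℕ)
    (ω : ℝ) : ∫ x in (-1 : ℝ)..1, p.eval (x : ℂ) * (x : ℂ) ^ k *
      Complex.exp (Complex.I * (ω : ℂ) * (x : ℂ))
      = ∑ j ∈ Finset.range n, p.coeff j * moment (j + k) ω := by
  simp only [moment, ← intervalIntegral.integral_const_mul]
  rw [← intervalIntegral.integral_finsetSum]
  · refine intervalIntegral.integral_congr fun x _ => ?_
    simp only [Polynomial.eval_eq_sum_range' hp, Finset.sum_mul]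
    refine Finset.sum_congr rfl fun j _ => ?_
    ring
  · intro j _
    refine Continuous.intervalIntegrable ?_ _ _
    fun_prop

/-- The leading coefficient is known to be 1, so its moments form the right-hand side of a square
linear system for the lower coefficients. -/
lemma isMonicOP_iff {n : ℕ} {ω : ℝ} {p : Polynomial ℂ} (hp : p.Monic) (hn : p.natDegree = n) :
    IsMonicOP n ω p ↔ (Matrix.of fun i j : Fin n => moment (i.val + j.val) ω).mulVec
      (fun j => p.coeff j) = fun k : Fin n => - moment (n + k) ω := by
  have key : ∀ k : ℕ, (∫ x in (-1 : ℝ)..1, p.eval (x : ℂ) * (x : ℂ) ^ k *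
      Complex.exp (Complex.I * (ω : ℂ) * (x : ℂ)))
      = ∑ j : Fin n, moment (k + j) ω * p.coeff j + moment (n + k) ω := by
    intro k
    rw [integral_eval_mul_pow_mul_exp (Nat.lt_succ_of_le hn.le), Finset.sum_range_succ,
      Finset.sum_range, ← hn, hp.coeff_natDegree, one_mul]
    congr 1
    refine Finset.sum_congr rfl fun j _ => ?_
    rw [mul_comm, add_comm]
  simp only [IsMonicOP, hp, hn, true_and, key, funext_iff, Matrix.mulVec, dotProduct,
    Matrix.of_apply]
  exact ⟨fun h k => eq_neg_of_add_eq_zero_left (h k k.2),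
    fun h k hk => by rw [h ⟨k, hk⟩, neg_add_cancel]⟩

/-- A nonvanishing Hankel determinant yields a unique monic orthogonal polynomial. -/
theorem existsUnique_isMonicOP {n : ℕ} {ω : ℝ}
    (h : (Matrix.of fun i j : Fin n => moment (i.val + j.val) ω).det ≠ 0) :
    ∃! p : Polynomial ℂ, IsMonicOP n ω p := by
  set M := Matrix.of fun i j : Fin n => moment (i.val + j.val) ω with hM
  have hu : IsUnit M.det := h.isUnit
  set c : Fin n → ℂ := M⁻¹.mulVec fun k : Fin n => - moment (n + k) ω with hc
  set q : Polynomial ℂ := ∑ j : Fin n, Polynomial.C (c j) * Polynomial.X ^ (j : ℕ) with hq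
  have hqdeg : q.degree < n := Polynomial.degree_sum_fin_lt c
  have hmonic : (Polynomial.X ^ n + q).Monic := Polynomial.monic_X_pow_add hqdeg
  have hdeg : (Polynomial.X ^ n + q).natDegree = n := by
    refine Polynomial.natDegree_eq_of_degree_eq_some ?_
    rw [Polynomial.degree_add_eq_left_of_degree_lt (by simpa using hqdeg), Polynomial.degree_X_pow]
  refine ⟨Polynomial.X ^ n + q, (isMonicOP_iff hmonic hdeg).2 ?_, fun p hp => ?_⟩
  · have hcoeff : (fun j : Fin n => (Polynomial.X ^ n + q).coeff j) = c := by
      ext j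
      rw [Polynomial.coeff_add, Polynomial.coeff_X_pow, if_neg j.2.ne, zero_add, hq,
        Polynomial.finsetSum_coeff, Finset.sum_eq_single j]
      · simp
      · intro k _ hk
        rw [Polynomial.coeff_C_mul_X_pow, if_neg fun h => hk (Fin.ext h.symm)]
      · simp
    rw [hcoeff, hc, Matrix.mulVec_mulVec, Matrix.mul_nonsing_inv _ hu, Matrix.one_mulVec]
  · have hp' := (isMonicOP_iff hp.1 hp.2.1).1 hp
    have hpc : (fun j : Fin n => p.coeff j) = c := by
      rw [hc, ← hp', Matrix.mulVec_mulVec, Matrix.nonsing_inv_mul _ hu, Matrix.one_mulVec]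
    rw [hp.1.as_sum, hp.2.1, hq, Finset.sum_range]
    congr 1
    refine Finset.sum_congr rfl fun j _ => ?_
    rw [← congrFun hpc j]

end Kissing


theorem mainTheorem2 (N : ℕ) (hN : 1 ≤ N) :
    (∀ (f : (Fin (2 * N) → ℝ) → ℂ) (v : Fin (2 * N) → ℝ),
      ContDiffOn ℝ ((⊤ : ℕ∞) : WithTop ℕ∞) f (Kissing.cube (2 * N)) →
      Kissing.IsSymmetricOnCube f →
      Kissing.IsVertex v → Kissing.weight v = 0 → f v ≠ 0 →
      (fun ω : ℝ => Kissing.symmetricIntegral (2 * N) f ω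
          - (4 : ℂ) ^ (N ^ 2) / (ω : ℂ) ^ (2 * N ^ 2) * f v
            * (Nat.superFactorial (N - 1) : ℂ) ^ 4)
        =O[Filter.atTop] fun ω : ℝ => (1 : ℝ) / ω ^ (2 * N ^ 2 + 1)) ∧
    (∀ ω : ℝ, Kissing.symmetricIntegral (2 * N) (fun _ => 1) ω
      = Kissing.hankelDet (2 * N - 1) ω) ∧
    (∀ᶠ ω : ℝ in Filter.atTop,
      (Kissing.hankelDet (2 * N - 1) ω).im = 0 ∧
        0 < (Kissing.hankelDet (2 * N - 1) ω).re) ∧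
    (∀ᶠ ω : ℝ in Filter.atTop, ∃! p : Polynomial ℂ, Kissing.IsMonicOP (2 * N) ω p) := by
  refine ⟨fun f v hf hsymm hv hv0 _ => ?_, Kissing.symmetricIntegral_one_eq_hankelDet hN, ?_, ?_⟩
  · simpa only [one_div] using Kissing.isBigO_symmetricIntegral_sub hN hf hsymm hv hv0
  · filter_upwards [Kissing.eventually_hankelDet_re_pos hN] with ω hω
    exact ⟨Kissing.hankelDet_im _ ω, hω⟩
  · filter_upwards [Kissing.eventually_hankelDet_re_pos hN] with ω hω
    refine Kissing.existsUnique_isMonicOP ?_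
    rw [← Kissing.symmetricIntegral_one, Kissing.symmetricIntegral_one_eq_hankelDet hN]
    intro h
    rw [h] at hω
    exact lt_irrefl _ hω
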